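/- Fix integers $m\ge 1$ and $p$, and vectors $a_r\in\mathbb C^m$, $a_t\in\mathbb C^p$ (steering vectors). For every number of snapshots $n$ let $S_n\in\mathbb C^{p\times n}$ be a known waveform, and put $N=mn$ and $Z_n=a_r a_t^H S_n\in\mathbb C^{m\times n}$. Assume the normalization $\operatorname{tr}(Z_nZ_n^H)=N$ for all $n$, and that the entries of $Z_n$ are bounded in modulus by a constant independent of $n$. Let $W_n\in\mathbb C^{m\times n}$ be noise whose entries have real and imaginary parts that are all independent standard Gaussian (complex noise variance $\sigma_n^2=2$), and for $\beta\in\mathbb C$ let $X_n=\beta Z_n+W_n$ be the unquantized data and $Y_n=\operatorname{sign}(\operatorname{Re}X_n)+\imath\operatorname{sign}(\operatorname{Im}X_n)$ (entrywise) the one-bit data. Let $T_R$ be Rao's test statistic for $\beta=0$ against $\beta\ne0$ based on $Y_n$, that is, $T_R=g^TF^{-1}g$, where $g$ is the gradient at $(a,b)=(0,0)$ of the log-likelihood of $Y_n$ as a function of $\beta=a+\imath b$, and $F$ is the Fisher information matrix at $(0,0)$. Let $T_{GLRT}$ be the generalized likelihood ratio for $\beta=0$ against $\beta\neq0$ based on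 the unquantized data $X_n$ with unknown noise variance, that is, the supremum over $v>0$ of the Gaussian likelihood with reflectivity $0$ and noise variance $v$, divided by the supremum over $\beta\in\mathbb C$ and $v>0$ of the Gaussian likelihood with reflectivity $\beta$ and noise variance $v$. Let $\chi^2_2(\delta^2)$ be the noncentral chi-squared law with two degrees of freedom and noncentrality parameter $\delta^2$. Let $(\beta_n)$ be complex numbers with $|\beta_n|=O(N^{-1/2})$ as $n\to\infty$. Then, as $n\to\infty$: 1. the Kolmogorov distance (the supremum over $x\in\mathbb R$ of the absolute difference of the distribution functions) between the law of $T_R$ under $\beta=\beta_n$ and $\chi^2_2(\delta_1^2)$, with $\delta_1^2=\frac{2N}{\pi}|\beta_n|^2$, tends to $0$; 2. the Kolmogorov distance between the law of $-2\log T_{GLRT}$ under $\beta=\beta_n$ and $\chi^2_2(\delta^2)$, with $\delta^2=N|\beta_n|^2$, tends to $0$. Consequently one-bit quantization costs a factor $\pi/2$: $\delta^2/\delta_1^2=\pi/2$ whenever $n\ge1$ and $\beta_n\ne0$; the Kolmogorov distance between the law of $T_R$ under $\beta=\sqrt{\pi/2}\,\beta_n$ and the law of $-2\log T_{GLRT}$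 under $\beta=\beta_n$ tends to $0$; and this loss of $10\log_{10}(\pi/2)$ dB is about $2$ dB, namely $|10\log_{10}(\pi/2)-2|<\frac1{20}$. -/

import Mathlib

open MeasureTheory ProbabilityTheory Filter Topology
open scoped Matrix

noncomputable section

namespace OneBitRadar

/-- Circular complex Gaussian law with total variance `2`: the real and imaginary parts are
independent standard real Gaussians. -/
def complexGaussian : Measure ℂ :=
  ((gaussianReal 0 1).prod (gaussianReal 0 1)).map (fun g : ℝ × ℝ => (⟨g.1, g.2⟩ : ℂ))

/-- White Gaussian noise: the entries of the `m × n` matrix are independent, each with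
law `complexGaussian`. -/
def noiseLaw (m n : ℕ) : Measure (Fin m → Fin n → ℂ) :=
  Measure.pi (fun _ => Measure.pi (fun _ => complexGaussian))

/-- The noise-free unit-reflectivity return `Z = a_r a_tᴴ S`. -/
def target {m p n : ℕ} (aR : Fin m → ℂ) (aT : Fin p → ℂ) (S : Matrix (Fin p) (Fin n) ℂ) :
    Matrix (Fin m) (Fin n) ℂ :=
  Matrix.vecMulVec aR (star aT) * S

/-- The unquantized data `X = β Z + W`. -/
def received {m n : ℕ} (Z : Matrix (Fin m) (Fin n) ℂ) (β : ℂ) (W : Fin m → Fin n → ℂ) :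
    Matrix (Fin m) (Fin n) ℂ :=
  β • Z + Matrix.of W

/-- One-bit quantization, entrywise: `sign (Re x) + i sign (Im x)`. -/
def quantize {m n : ℕ} (X : Matrix (Fin m) (Fin n) ℂ) : Matrix (Fin m) (Fin n) ℂ :=
  X.map (fun x => (⟨Real.sign x.re, Real.sign x.im⟩ : ℂ))

/-- The Gaussian tail function `Q(x) = ∫_x^∞ (2π)^(-1/2) exp (-t²/2) dt`. -/
def gaussianQ (x : ℝ) : ℝ :=
  ∫ t in Set.Ioi x, 1 / Real.sqrt (2 * Real.pi) * Real.exp (-t ^ 2 / 2)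

/-- The reflectivity `β = a + i b` with real parameters `θ = (a, b)`. -/
def reflectivity (θ : Fin 2 → ℝ) : ℂ := ⟨θ 0, θ 1⟩

/-- Log-likelihood of one-bit data `Y` at the parameter `θ`, for noise of variance `2`. -/
def logLikelihood {m n : ℕ} (Z Y : Matrix (Fin m) (Fin n) ℂ) (θ : Fin 2 → ℝ) : ℝ :=
  (∑ i, ∑ j, Real.log (gaussianQ (-(Y i j).re * (reflectivity θ * Z i j).re))) +
    ∑ i, ∑ j, Real.log (gaussianQ (-(Y i j).im * (reflectivity θ * Z i j).im))

/-- The score: the vector of partial derivatives of the log-likelihood. -/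
def score {m n : ℕ} (Z Y : Matrix (Fin m) (Fin n) ℂ) (θ : Fin 2 → ℝ) : Fin 2 → ℝ :=
  fun k => deriv (fun t : ℝ => logLikelihood Z Y (Function.update θ k t)) (θ k)

/-- The Fisher information matrix of the one-bit data at `θ`: the second-moment matrix of the
score when the true parameter is `θ`. -/
def fisherInformation {m n : ℕ} (Z : Matrix (Fin m) (Fin n) ℂ) (θ : Fin 2 → ℝ) :
    Matrix (Fin 2) (Fin 2) ℝ :=
  Matrix.of fun k l =>
    ∫ W, score Z (quantize (received Z (reflectivity θ) W)) θ k *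
      score Z (quantize (received Z (reflectivity θ) W)) θ l ∂(noiseLaw m n)

/-- Rao's test statistic for `β = 0` against `β ≠ 0` from one-bit data `Y`. -/
def raoStatistic {m n : ℕ} (Z Y : Matrix (Fin m) (Fin n) ℂ) : ℝ :=
  score Z Y 0 ⬝ᵥ ((fisherInformation Z 0)⁻¹ *ᵥ score Z Y 0)

/-- Density of the unquantized data `X` when the reflectivity is `β` and the complex noise has
variance `v`. -/
def gaussianLikelihood {m n : ℕ} (Z X : Matrix (Fin m) (Fin n) ℂ) (β : ℂ) (v : ℝ) : ℝ :=
  1 / (Real.pi * v) ^ (m * n) * Real.exp (-(∑ i, ∑ j, ‖X i j - β * Z i j‖ ^ 2) / v)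

/-- The generalized likelihood ratio for `β = 0` against `β ≠ 0` from unquantized data `X`, the
noise variance being an unknown nuisance parameter. (The null hypothesis is in the numerator.) -/
def glrtStatistic {m n : ℕ} (Z X : Matrix (Fin m) (Fin n) ℂ) : ℝ :=
  (⨆ v : Set.Ioi (0 : ℝ), gaussianLikelihood Z X 0 v) /
    ⨆ q : ℂ × Set.Ioi (0 : ℝ), gaussianLikelihood Z X q.1 q.2

/-- The noncentral chi-squared law with `k` degrees of freedom and noncentrality `δsq`: the law of
`∑ i, (gᵢ + μᵢ)²` with `gᵢ` independent standard Gaussians and `μ = (√δsq, 0, …, 0)`. -/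
def noncentralChiSq (k : ℕ) (δsq : ℝ) : Measure ℝ :=
  (Measure.pi (fun _ : Fin k => gaussianReal 0 1)).map
    (fun g => ∑ i : Fin k, (g i + if (i : ℕ) = 0 then Real.sqrt δsq else 0) ^ 2)

/-- Distribution function, under reflectivity `β`, of Rao's statistic for one-bit data. -/
def raoCDF {m n : ℕ} (Z : Matrix (Fin m) (Fin n) ℂ) (β : ℂ) (x : ℝ) : ℝ :=
  (noiseLaw m n).real {W | raoStatistic Z (quantize (received Z β W)) ≤ x}

/-- Distribution function, under reflectivity `β`, of `-2 log` of the generalized likelihood ratio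
for unquantized data. -/
def glrtCDF {m n : ℕ} (Z : Matrix (Fin m) (Fin n) ℂ) (β : ℂ) (x : ℝ) : ℝ :=
  (noiseLaw m n).real {W | -2 * Real.log (glrtStatistic Z (received Z β W)) ≤ x}

/-- The sequences `F n` and `G n` of distribution functions approximate each other: their
Kolmogorov distance `sup_x |F n x - G n x|` tends to zero. -/
def AsympEq (F G : ℕ → ℝ → ℝ) : Prop :=
  ∀ ε > 0, ∀ᶠ n in atTop, ∀ x : ℝ, |F n x - G n x| ≤ ε

end OneBitRadar

end

open OneBitRadar

namespace OneBitRadar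

/-! Both statistics are governed by the matched-filter output V = tr(Zᴴ·)/√N, a normalized sum over
the entries of the data.

For one-bit data the score at 0 is linear in Y, with real components √(2/π)·√N·(Re V, Im V). Under β
= 0 the signs are centred, uncorrelated and of unit variance, so the Fisher matrix is the scalar
matrix 2N/π, and Rao's statistic is exactly ‖V(Y)‖² (`raoStatistic_eq`). For unquantized data,
maximizing over v and fitting β by least squares gives the ratio (1 - ‖V(X)‖²/E)^N, with E the total
energy (`glrtStatistic_eq`). By the weak law E is close to 2N, so -2 log of it is close to ‖V(X)‖².

It remains to find the law of V. Linear filtering preserves Gaussianity, so V(X) is a standard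
complex Gaussian shifted by √N β, and ‖V(X)‖² is exactly noncentral chi-squared. V(Y) requires a
central limit theorem: the sign of μ + g has mean √(2/π) μ + o(μ) and unit second moment, so each
factor of its characteristic function is, up to a small multiple of the squared weight and squared
mean, that of a Gaussian shifted by √(2/π) times the signal. The errors sum to ε(‖t‖² + N‖β‖²),
which is small because N‖β‖² is bounded (`norm_charFun_oneBitFilterLaw_sub_le`). The lost factor π/2
is the inverse square of this slope.

The shifts vary with n but stay bounded, so compactness and Lévy's continuity theorem give weak
closeness. The limiting distribution functions are Lipschitz uniformly in the shift, which upgrades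
this to Kolmogorov distance. -/

/-! ### The standard complex Gaussian: characteristic function, rotation invariance, density bound.
-/

lemma measurePreserving_complexGaussian :
    MeasurePreserving Complex.measurableEquivRealProd.symm
      ((gaussianReal 0 1).prod (gaussianReal 0 1)) complexGaussian :=
  ⟨Complex.measurableEquivRealProd.symm.measurable, rfl⟩

instance : IsProbabilityMeasure complexGaussian :=
  Measure.isProbabilityMeasure_map Complex.measurableEquivRealProd.symm.measurable.aemeasurable

lemma integral_complexGaussian_mul {L : Type*} [RCLike L] (f g : ℝ → L) :
    ∫ w, f w.re * g w.im ∂complexGaussian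
      = (∫ x, f x ∂gaussianReal 0 1) * ∫ x, g x ∂gaussianReal 0 1 := by
  rw [← measurePreserving_complexGaussian.integral_comp
    Complex.measurableEquivRealProd.symm.measurableEmbedding, ← integral_prod_mul]
  rfl

lemma inner_eq_re_mul_add_im_mul (z w : ℂ) : inner ℝ z w = z.re * w.re + z.im * w.im := by
  rw [Complex.inner]; simp; ring

lemma exp_inner_mul_I (z w : ℂ) : Complex.exp ((inner ℝ z w : ℝ) * Complex.I)
    = Complex.exp ((z.re * w.re : ℝ) * Complex.I) *
      Complex.exp ((z.im * w.im : ℝ) * Complex.I) := by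
  rw [inner_eq_re_mul_add_im_mul, ← Complex.exp_add]
  congr 1; push_cast; ring

lemma charFun_complexGaussian (t : ℂ) :
    charFun complexGaussian t = Complex.exp (-(‖t‖ ^ 2 / 2 : ℝ)) := by
  simp_rw [charFun_apply, exp_inner_mul_I]
  rw [integral_complexGaussian_mul (fun x => Complex.exp ((x * t.re : ℝ) * Complex.I))
    (fun x => Complex.exp ((x * t.im : ℝ) * Complex.I))]
  have h : ∀ s : ℝ, ∫ x, Complex.exp ((x * s : ℝ) * Complex.I) ∂gaussianReal 0 1
      = Complex.exp (-(s ^ 2 / 2 : ℝ)) := fun s => by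
    have := charFun_gaussianReal (μ := 0) (v := 1) s
    rw [charFun_apply] at this
    simp only [RCLike.inner_apply, conj_trivial] at this
    simp only [mul_comm _ s]
    rw [this]; congr 1; simp
  rw [h, h, ← Complex.exp_add, Complex.sq_norm, Complex.normSq_apply]
  congr 1; push_cast; ring

lemma charFun_complexGaussian_map_add (t m : ℂ) :
    charFun (complexGaussian.map (· + m)) t
      = Complex.exp ((inner ℝ m t : ℝ) * Complex.I - (‖t‖ ^ 2 / 2 : ℝ)) := by
  rw [charFun_map_add_const, charFun_complexGaussian, ← Complex.exp_add]
  congr 1; push_cast; ring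

/-- The characteristic function depends only on ‖t‖, and multiplication by u is adjoint to
multiplication by its conjugate, which preserves norms. -/
lemma complexGaussian_map_mul {u : ℂ} (hu : ‖u‖ = 1) :
    complexGaussian.map (u * ·) = complexGaussian := by
  have : IsProbabilityMeasure (complexGaussian.map (u * ·)) :=
    Measure.isProbabilityMeasure_map (by fun_prop)
  refine Measure.ext_of_charFun (funext fun t => ?_)
  have h := charFun_complexGaussian (star u * t)
  rw [norm_mul, norm_star, hu, one_mul] at h
  rw [charFun_complexGaussian, ← h, charFun_apply, charFun_apply,
    integral_map (by fun_prop) (by fun_prop)]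
  congr with x
  rw [Complex.inner, Complex.inner]
  congr 4
  simp; ring

lemma gaussianReal_le_volume : gaussianReal 0 1 ≤ volume := by
  rw [gaussianReal_of_var_ne_zero _ one_ne_zero]
  calc _ ≤ volume.withDensity 1 := withDensity_mono (ae_of_all _ fun x => ?_)
    _ = volume := withDensity_one
  have h : gaussianPDFReal 0 1 x ≤ 1 := by
    rw [gaussianPDFReal_def]
    refine mul_le_one₀ (inv_le_one_of_one_le₀ ?_) (Real.exp_nonneg _) (Real.exp_le_one_iff.2 ?_)
    · rw [Real.one_le_sqrt]; have := Real.pi_gt_three; simp; linarith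
    · simp only [neg_div, Left.neg_nonpos_iff]; positivity
  simpa [gaussianPDF] using h

/-- A crude density bound by 1. It makes probabilities of planar regions at most their areas, which
is all that the Lipschitz estimate below needs. -/
lemma complexGaussian_le_volume : complexGaussian ≤ volume := by
  have h := Measure.map_mono (Measure.prod_mono gaussianReal_le_volume gaussianReal_le_volume)
    Complex.measurableEquivRealProd.symm.measurable
  rw [measurePreserving_complexGaussian.map_eq] at h
  exact h.trans_eq Complex.volume_preserving_equiv_real_prod.symm.map_eq

/-! ### Noncentral chi-squared with two degrees of freedom as the law of a squared norm. -/

lemma setOf_norm_sq_le {x : ℝ} (hx : 0 ≤ x) (m : ℂ) :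
    {w : ℂ | ‖w + m‖ ^ 2 ≤ x} = Metric.closedBall (-m) (Real.sqrt x) := by
  ext w
  rw [Set.mem_ofPred_eq, mem_closedBall_iff_norm, sub_neg_eq_add, Real.le_sqrt (norm_nonneg _) hx]

/-- Distribution function of `‖w + m‖²` for a standard complex Gaussian `w`. -/
noncomputable def shiftedNormSqCDF (m : ℂ) (x : ℝ) : ℝ :=
  complexGaussian.real {w | ‖w + m‖ ^ 2 ≤ x}

lemma shiftedNormSqCDF_mono (m : ℂ) : Monotone (shiftedNormSqCDF m) := fun _ _ h =>
  measureReal_mono fun _ hw => le_trans (by simpa using hw) h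

lemma shiftedNormSqCDF_of_neg (m : ℂ) {x : ℝ} (hx : x < 0) : shiftedNormSqCDF m x = 0 := by
  have : {w : ℂ | ‖w + m‖ ^ 2 ≤ x} = ∅ := by
    ext w; simpa using hx.trans_le (by positivity)
  simp [shiftedNormSqCDF, this]

/-- The increment is the mass of an annulus of area π h, whatever its radius and centre. The
constant does not depend on m, which matters because the shift varies with n. -/
lemma shiftedNormSqCDF_add_le (m : ℂ) (x : ℝ) {h : ℝ} (hh : 0 ≤ h) :
    shiftedNormSqCDF m (x + h) ≤ shiftedNormSqCDF m x + Real.pi * h := by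
  have key : ∀ x h : ℝ, 0 ≤ x → 0 ≤ h →
      shiftedNormSqCDF m (x + h) ≤ shiftedNormSqCDF m x + Real.pi * h := by
    intro x h hx hh
    have hsub : {w : ℂ | ‖w + m‖ ^ 2 ≤ x} ⊆ {w : ℂ | ‖w + m‖ ^ 2 ≤ x + h} :=
      fun w (hw : _ ≤ x) => hw.trans (le_add_of_nonneg_right hh)
    have hmeas : MeasurableSet {w : ℂ | ‖w + m‖ ^ 2 ≤ x} := by
      rw [setOf_norm_sq_le hx]; exact measurableSet_closedBall
    rw [← sub_le_iff_le_add', shiftedNormSqCDF, shiftedNormSqCDF, ← measureReal_sdiff hsub hmeas]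
    have hv : ∀ y : ℝ, 0 ≤ y → volume.real {w : ℂ | ‖w + m‖ ^ 2 ≤ y} = Real.pi * y := by
      intro y hy
      rw [setOf_norm_sq_le hy, measureReal_def, Complex.volume_closedBall]
      simp [Real.sq_sqrt hy, ENNReal.toReal_ofReal, mul_comm]
    have hfin : volume {w : ℂ | ‖w + m‖ ^ 2 ≤ x + h} ≠ ⊤ := by
      rw [setOf_norm_sq_le (by positivity)]; exact measure_closedBall_lt_top.ne
    calc _ ≤ volume.real ({w : ℂ | ‖w + m‖ ^ 2 ≤ x + h} \ {w : ℂ | ‖w + m‖ ^ 2 ≤ x}) :=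
          ENNReal.toReal_mono (measure_ne_top_of_subset Set.sdiff_subset hfin)
            (complexGaussian_le_volume _)
      _ = Real.pi * h := by
          rw [measureReal_sdiff hsub hmeas hfin, hv _ (by positivity), hv _ hx]; ring
  rcases le_or_gt 0 x with hx | hx
  · exact key x h hx hh
  · rw [shiftedNormSqCDF_of_neg m hx, zero_add]
    rcases lt_or_ge (x + h) 0 with hx' | hx'
    · rw [shiftedNormSqCDF_of_neg m hx']; positivity
    -- When the interval straddles 0, start from 0 instead: the distribution function vanishes there
    -- because a point is null.
    · have h1 := key 0 (x + h) le_rfl hx'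
      have h0 : shiftedNormSqCDF m 0 ≤ 0 := by
        refine le_of_forall_pos_le_add fun ε hε => ?_
        rw [shiftedNormSqCDF, setOf_norm_sq_le le_rfl, Real.sqrt_zero]
        have := complexGaussian_le_volume (Metric.closedBall (-m) 0)
        rw [Complex.volume_closedBall] at this
        simp at this
        simp [measureReal_def, this, hε.le]
      rw [zero_add] at h1
      have : Real.pi * (x + h) ≤ Real.pi * h := by
        apply mul_le_mul_of_nonneg_left _ Real.pi_pos.le; linarith
      linarith

/-- Rotation invariance turns the shift m onto the positive real axis, the position used in
`noncentralChiSq`. -/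
lemma noncentralChiSq_two_real_Iic {m : ℂ} {δsq : ℝ} (h : ‖m‖ ^ 2 = δsq) (x : ℝ) :
    (noncentralChiSq 2 δsq).real (Set.Iic x) = shiftedNormSqCDF m x := by
  obtain ⟨u, hu, hm⟩ : ∃ u : ℂ, ‖u‖ = 1 ∧ m = u * ‖m‖ := by
    rcases eq_or_ne m 0 with rfl | hm
    · exact ⟨1, by simp⟩
    · have : (‖m‖ : ℂ) ≠ 0 := by simpa using hm
      exact ⟨m / ‖m‖, by simp [hm], by field_simp⟩
  have hrot : shiftedNormSqCDF m x = shiftedNormSqCDF (‖m‖ : ℂ) x := by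
    rw [shiftedNormSqCDF, ← complexGaussian_map_mul hu, map_measureReal_apply (by fun_prop)
      (measurableSet_le (by fun_prop) (by fun_prop)), shiftedNormSqCDF]
    congr 1; ext w
    simp only [Set.preimage_ofPred_eq, Set.mem_ofPred_eq]
    conv_lhs => rw [hm, ← mul_add, norm_mul, hu, one_mul]
  have hs : Real.sqrt δsq = ‖m‖ := by rw [← h, Real.sqrt_sq (norm_nonneg _)]
  rw [hrot, noncentralChiSq, map_measureReal_apply (by fun_prop) measurableSet_Iic,
    shiftedNormSqCDF, measureReal_def, measureReal_def,
    ← (measurePreserving_complexGaussian.comp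
      (measurePreserving_finTwoArrow (gaussianReal 0 1))).measure_preimage
      (measurableSet_le (by fun_prop) (by fun_prop)).nullMeasurableSet]
  congr 2
  ext g
  simp [Complex.sq_norm, Complex.normSq_apply, hs, ← sq, Complex.measurableEquivRealProd]

/-! ### Kolmogorov closeness and its criteria. -/

lemma AsympEq.symm {F G : ℕ → ℝ → ℝ} (h : AsympEq F G) : AsympEq G F := fun ε hε => by
  simpa only [abs_sub_comm] using h ε hε

lemma AsympEq.trans {F G H : ℕ → ℝ → ℝ} (h : AsympEq F G) (h' : AsympEq G H) : AsympEq F H := by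
  intro ε hε
  filter_upwards [h _ (half_pos hε), h' _ (half_pos hε)] with n h1 h2 x
  linarith [abs_sub_le (F n x) (G n x) (H n x), h1 x, h2 x]

/-- A horizontal shift by η costs at most Cη vertically, so closeness in the Lévy sense is closeness
in the Kolmogorov sense. -/
lemma asympEq_of_shift {F G : ℕ → ℝ → ℝ} {C : ℝ}
    (hG : ∀ n x h, 0 ≤ h → G n (x + h) ≤ G n x + C * h)
    (h : ∀ η > 0, ∀ δ > 0, ∀ᶠ n in atTop, ∀ x,
      F n x ≤ G n (x + η) + δ ∧ G n (x - η) ≤ F n x + δ) : AsympEq F G := by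
  intro ε hε
  have hC : 0 < |C| + 1 := by positivity
  have hη : 0 < ε / 2 / (|C| + 1) := by positivity
  filter_upwards [h _ hη _ (half_pos hε)] with n hn x
  have hb : C * (ε / 2 / (|C| + 1)) ≤ ε / 2 := by
    calc C * (ε / 2 / (|C| + 1)) ≤ (|C| + 1) * (ε / 2 / (|C| + 1)) := by
          gcongr; linarith [le_abs_self C]
      _ = ε / 2 := by field_simp
  have h1 := hG n x _ hη.le
  have h2 := hG n (x - ε / 2 / (|C| + 1)) _ hη.le
  rw [sub_add_cancel] at h2
  rw [abs_le]
  constructor <;> linarith [(hn x).1, (hn x).2]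

/-- **Pólya's theorem**: distribution functions that converge pointwise to a Lipschitz distribution
function converge uniformly. -/
lemma asympEq_of_tendsto {F : ℕ → ℝ → ℝ} {G : ℝ → ℝ} {C : ℝ} (hF : ∀ n, Monotone (F n))
    (hF0 : ∀ n x, 0 ≤ F n x) (hF1 : ∀ n x, F n x ≤ 1) (hGm : Monotone G)
    (hG : ∀ x h, 0 ≤ h → G (x + h) ≤ G x + C * h)
    (hG0 : Tendsto G atBot (𝓝 0)) (hG1 : Tendsto G atTop (𝓝 1))
    (h : ∀ x, Tendsto (F · x) atTop (𝓝 (G x))) : AsympEq F fun _ => G := by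
  intro ε hε
  have hnn : ∀ x, 0 ≤ G x := fun x => ge_of_tendsto' (h x) (hF0 · x)
  have hle1 : ∀ x, G x ≤ 1 := fun x => le_of_tendsto' (h x) (hF1 · x)
  obtain ⟨a, ha⟩ := (hG0.eventually_le_const (half_pos hε)).exists
  obtain ⟨b, hb⟩ := (hG1.eventually_const_le (show 1 - ε / 2 < 1 by linarith)).exists
  -- Mesh on which G rises by at most ε/2 per cell. Convergence at the finitely many grid points
  -- plus monotonicity handles [a, b], and the limits of G handle the tails.
  set d : ℝ := ε / 2 / (|C| + 1) with hd
  have hdpos : 0 < d := by positivity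
  have hCd : C * d ≤ ε / 2 := by
    calc C * d ≤ (|C| + 1) * d := by gcongr; linarith [le_abs_self C]
      _ = ε / 2 := by rw [hd]; field_simp
  obtain ⟨K, hK⟩ := exists_nat_ge ((b - a) / d)
  have hKb : b ≤ a + K * d := by
    rw [div_le_iff₀ hdpos] at hK; linarith
  have hgrid : ∀ᶠ n in atTop, ∀ i ∈ Finset.range (K + 1),
      |F n (a + i * d) - G (a + i * d)| ≤ ε / 2 := by
    rw [Filter.eventually_all_finset]
    intro i _
    have := (h (a + i * d)).sub_const (G (a + i * d))
    rw [sub_self] at this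
    simpa using (this.abs.eventually_le_const (show |(0 : ℝ)| < ε / 2 by simpa using half_pos hε))
  filter_upwards [hgrid] with n hn x
  have hn' : ∀ i : ℕ, i ≤ K → F n (a + i * d) ≤ G (a + i * d) + ε / 2 ∧
      G (a + i * d) ≤ F n (a + i * d) + ε / 2 := by
    intro i hi
    have := abs_le.1 (hn i (Finset.mem_range_succ_iff.2 hi))
    constructor <;> linarith
  rw [abs_le]
  rcases lt_or_ge x a with hxa | hxa
  · have h0 := (hn' 0 (Nat.zero_le _)).1
    simp only [Nat.cast_zero, zero_mul, add_zero] at h0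
    constructor <;> linarith [hF n hxa.le, hGm hxa.le, hF0 n x, hnn x]
  rcases le_or_gt (a + K * d) x with hxb | hxb
  · have h0 := (hn' K le_rfl).2
    constructor <;> linarith [hF n hxb, hGm hxb, hF1 n x, hle1 x, hGm hKb]
  · set i := ⌊(x - a) / d⌋₊ with hi
    have hi1 : (i : ℝ) * d ≤ x - a := by
      rw [← le_div_iff₀ hdpos]; exact Nat.floor_le (div_nonneg (by linarith) hdpos.le)
    have hi2 : x - a < ((i + 1 : ℕ) : ℝ) * d := by
      rw [← div_lt_iff₀ hdpos]; push_cast; exact Nat.lt_floor_add_one _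
    have hiK : i + 1 ≤ K := by
      have : (i : ℝ) * d < K * d := by linarith
      exact_mod_cast lt_of_mul_lt_mul_right this hdpos.le
    have hl : a + i * d ≤ x := by linarith
    have hr : x ≤ a + (i + 1 : ℕ) * d := by linarith
    have h1 := hG (a + i * d) d hdpos.le
    have heq : a + ((i + 1 : ℕ) : ℝ) * d = a + i * d + d := by push_cast; ring
    have h2 := (hn' (i + 1) hiK).1
    have h3 := (hn' i (by omega)).2
    have h4 := hF n hl
    have h5 := hF n hr
    have h6 := hGm hl
    have h7 := hGm hr
    rw [heq] at h2 h5 h7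
    constructor <;> linarith

lemma tendsto_shiftedNormSqCDF_atTop (m : ℂ) :
    Tendsto (shiftedNormSqCDF m) atTop (𝓝 1) := by
  have h := tendsto_measure_iUnion_atTop (μ := complexGaussian)
    (s := fun x : ℝ => {w : ℂ | ‖w + m‖ ^ 2 ≤ x}) (fun _ _ hxy _ (hw : _ ≤ _) => hw.trans hxy)
  have hU : (⋃ x : ℝ, {w : ℂ | ‖w + m‖ ^ 2 ≤ x}) = Set.univ :=
    Set.eq_univ_of_forall fun w => Set.mem_iUnion.2 ⟨‖w + m‖ ^ 2, le_refl (‖w + m‖ ^ 2)⟩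
  rw [hU, measure_univ] at h
  rw [← ENNReal.toReal_one]
  exact (ENNReal.tendsto_toReal ENNReal.one_ne_top).comp h

lemma tendsto_shiftedNormSqCDF_atBot (m : ℂ) :
    Tendsto (shiftedNormSqCDF m) atBot (𝓝 0) :=
  tendsto_const_nhds.congr' <| (eventually_lt_atBot 0).mono fun _ hx =>
    (shiftedNormSqCDF_of_neg m hx).symm

instance (m : ℂ) : IsProbabilityMeasure (complexGaussian.map (· + m)) :=
  Measure.isProbabilityMeasure_map (by fun_prop)

lemma map_add_real_setOf_norm_sq_le (m : ℂ) (x : ℝ) :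
    (complexGaussian.map (· + m)).real {v : ℂ | ‖v‖ ^ 2 ≤ x} = shiftedNormSqCDF m x := by
  rw [map_measureReal_apply (by fun_prop) (measurableSet_le (by fun_prop) (by fun_prop))]
  rfl

/-- Continuity of the distribution function: the circle lies in an annulus of arbitrarily small
mass. -/
lemma complexGaussian_map_add_sphere (m : ℂ) (x : ℝ) :
    (complexGaussian.map (· + m)) {v : ℂ | ‖v‖ ^ 2 = x} = 0 := by
  rw [← measureReal_eq_zero_iff]
  refine le_antisymm (le_of_forall_pos_le_add fun ε hε => ?_) measureReal_nonneg
  have hd : 0 < ε / Real.pi := by positivity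
  have h1 := shiftedNormSqCDF_add_le m (x - ε / Real.pi) hd.le
  rw [sub_add_cancel, mul_div_cancel₀ _ Real.pi_pos.ne', ← map_add_real_setOf_norm_sq_le,
    ← map_add_real_setOf_norm_sq_le] at h1
  have hdisj : Disjoint {v : ℂ | ‖v‖ ^ 2 = x} {v : ℂ | ‖v‖ ^ 2 ≤ x - ε / Real.pi} := by
    rw [Set.disjoint_left]
    intro v (hv : ‖v‖ ^ 2 = x) (hv' : ‖v‖ ^ 2 ≤ x - ε / Real.pi)
    linarith
  have h2 := measureReal_union (μ := complexGaussian.map (· + m)) hdisj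
    (measurableSet_le (by fun_prop) (by fun_prop))
  have h3 : (complexGaussian.map (· + m)).real
      ({v : ℂ | ‖v‖ ^ 2 = x} ∪ {v : ℂ | ‖v‖ ^ 2 ≤ x - ε / Real.pi}) ≤
      (complexGaussian.map (· + m)).real {v : ℂ | ‖v‖ ^ 2 ≤ x} := by
    refine measureReal_mono ?_
    rintro v ((hv : ‖v‖ ^ 2 = x) | (hv : ‖v‖ ^ 2 ≤ x - ε / Real.pi))
    · exact hv.le
    · exact hv.trans (sub_le_self _ hd.le)
  linarith

/-- Lévy's theorem gives weak convergence, the null boundary of a disc gives pointwise convergence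
of distribution functions, and Pólya's theorem makes it uniform. -/
lemma asympEq_of_tendsto_charFun {ν : ℕ → ProbabilityMeasure ℂ} {m : ℂ}
    (h : ∀ t : ℂ, Tendsto (fun n => charFun (ν n : Measure ℂ) t) atTop
      (𝓝 (charFun (complexGaussian.map (· + m)) t))) :
    AsympEq (fun n x => (ν n : Measure ℂ).real {v : ℂ | ‖v‖ ^ 2 ≤ x})
      fun _ => shiftedNormSqCDF m := by
  let ν₀ : ProbabilityMeasure ℂ := ⟨complexGaussian.map (· + m), inferInstance⟩
  have hlim : Tendsto ν atTop (𝓝 ν₀) := ProbabilityMeasure.tendsto_iff_tendsto_charFun.2 h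
  refine asympEq_of_tendsto (fun n x y hxy => measureReal_mono fun v (hv : _ ≤ _) => hv.trans hxy)
    (fun _ _ => measureReal_nonneg) (fun _ _ => measureReal_le_one) (shiftedNormSqCDF_mono m)
    (fun x _ => shiftedNormSqCDF_add_le m x) (tendsto_shiftedNormSqCDF_atBot m)
    (tendsto_shiftedNormSqCDF_atTop m) fun x => ?_
  have hfr : (ν₀ : Measure ℂ) (frontier {v : ℂ | ‖v‖ ^ 2 ≤ x}) = 0 :=
    measure_mono_null (frontier_le_subset_eq (by fun_prop) (by fun_prop))
      (complexGaussian_map_add_sphere m x)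
  rw [← map_add_real_setOf_norm_sq_le]
  exact (ENNReal.tendsto_toReal (measure_ne_top _ _)).comp
    (ProbabilityMeasure.tendsto_measure_of_null_frontier_of_tendsto' hlim hfr)

/-- If the characteristic functions of `ν n` are asymptotically those of a standard complex
Gaussian shifted by a bounded sequence `m n`, then the laws of the squared norms are close in
Kolmogorov distance. -/
lemma asympEq_of_charFun_sub_tendsto_zero {ν : ℕ → ProbabilityMeasure ℂ} {m : ℕ → ℂ} {C : ℝ}
    (hm : ∀ᶠ n in atTop, ‖m n‖ ≤ C)
    (h : ∀ t : ℂ, Tendsto (fun n => charFun (ν n : Measure ℂ) t -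
      charFun (complexGaussian.map (· + m n)) t) atTop (𝓝 0)) :
    AsympEq (fun n x => (ν n : Measure ℂ).real {v : ℂ | ‖v‖ ^ 2 ≤ x})
      fun n => shiftedNormSqCDF (m n) := by
  intro ε hε
  by_contra hcon
  rw [Filter.not_eventually] at hcon
  -- Along a subsequence of failures the bounded shifts have a convergent subsequence. There both
  -- families tend to the same fixed limit, a contradiction.
  obtain ⟨φ, hφ, hP⟩ := Filter.extraction_of_frequently_atTop (hcon.and_eventually hm)
  obtain ⟨m₀, -, ψ, hψ, hlim⟩ := tendsto_subseq_of_bounded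
    (Metric.isBounded_closedBall (x := (0 : ℂ)) (r := C)) (x := m ∘ φ)
    fun n => by simpa using (hP n).2
  have hlim' : ∀ t : ℂ, Tendsto (fun k => charFun (complexGaussian.map (· + m (φ (ψ k)))) t) atTop
      (𝓝 (charFun (complexGaussian.map (· + m₀)) t)) := by
    intro t
    simp only [charFun_complexGaussian_map_add]
    have hc : Continuous fun z : ℂ =>
        Complex.exp ((inner ℝ z t : ℝ) * Complex.I - (‖t‖ ^ 2 / 2 : ℝ)) := by fun_prop
    exact (hc.tendsto m₀).comp hlim
  have h1 : AsympEq (fun k x => (ν (φ (ψ k)) : Measure ℂ).real {v : ℂ | ‖v‖ ^ 2 ≤ x})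
      fun _ => shiftedNormSqCDF m₀ := by
    refine asympEq_of_tendsto_charFun (ν := fun k => ν (φ (ψ k))) fun t => ?_
    have := ((h t).comp (hφ.comp hψ).tendsto_atTop).add (hlim' t)
    simpa using this
  have h2 : AsympEq (fun k => shiftedNormSqCDF (m (φ (ψ k)))) fun _ => shiftedNormSqCDF m₀ := by
    have := asympEq_of_tendsto_charFun
      (ν := fun k => ⟨complexGaussian.map (· + m (φ (ψ k))), inferInstance⟩) hlim'
    simpa only [ProbabilityMeasure.coe_mk, map_add_real_setOf_norm_sq_le] using this
  obtain ⟨k, hk⟩ := ((h1.trans h2.symm) ε hε).exists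
  exact (hP (ψ k)).1 hk

/-! ### Independence and marginals of the noise entries. -/

instance (m n : ℕ) : IsProbabilityMeasure (noiseLaw m n) := by
  unfold noiseLaw; infer_instance

lemma iIndepFun_noise_entry (m n : ℕ) :
    iIndepFun (fun (q : Fin m × Fin n) (W : Fin m → Fin n → ℂ) => W q.1 q.2) (noiseLaw m n) := by
  have h := iIndepFun_uncurry_infinitePi' (ι := Fin m) (κ := Fin n) (Ω := fun _ _ => ℂ)
    (X := fun _ _ w => w) (fun _ _ => complexGaussian) (fun _ _ => measurable_id)
  simp only [Measure.infinitePi_eq_pi] at h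
  exact h

lemma measurePreserving_noise_entry {m n : ℕ} (q : Fin m × Fin n) :
    MeasurePreserving (fun W : Fin m → Fin n → ℂ => W q.1 q.2) (noiseLaw m n) complexGaussian :=
  (measurePreserving_eval (fun _ : Fin n => complexGaussian) q.2).comp
    (measurePreserving_eval (fun _ : Fin m => Measure.pi fun _ : Fin n => complexGaussian) q.1)

lemma integral_noise_entry {m n : ℕ} {E : Type*} [NormedAddCommGroup E] [NormedSpace ℝ E]
    (q : Fin m × Fin n) {f : ℂ → E} (hf : AEStronglyMeasurable f complexGaussian) :
    ∫ W, f (W q.1 q.2) ∂noiseLaw m n = ∫ w, f w ∂complexGaussian := by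
  rw [← (measurePreserving_noise_entry q).map_eq] at hf ⊢
  exact (integral_map (measurePreserving_noise_entry q).measurable.aemeasurable hf).symm

/-! ### The Gaussian tail and the moments of a quantized Gaussian. -/

lemma gaussianQ_integrand_eq (t : ℝ) :
    1 / Real.sqrt (2 * Real.pi) * Real.exp (-t ^ 2 / 2) = gaussianPDFReal 0 1 t := by
  simp [gaussianPDFReal_def]

lemma gaussianQ_eq (x : ℝ) : gaussianQ x = (gaussianReal 0 1).real (Set.Ioi x) := by
  simp only [gaussianQ, gaussianQ_integrand_eq]
  rw [measureReal_def, gaussianReal_apply_eq_integral _ one_ne_zero, ENNReal.toReal_ofReal]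
  exact integral_nonneg fun t => gaussianPDFReal_nonneg _ _ _

lemma gaussianQ_zero : gaussianQ 0 = 1 / 2 := by
  have h := integral_gaussian_Ioi (1 / 2)
  have h' : ∀ t : ℝ, -t ^ 2 / 2 = -(1 / 2) * t ^ 2 := fun t => by ring
  simp only [gaussianQ, h']
  rw [integral_const_mul, h]
  have : Real.pi / (1 / 2) = 2 * Real.pi := by ring
  rw [this]
  have : Real.sqrt (2 * Real.pi) ≠ 0 := by positivity
  field_simp

lemma hasDerivAt_gaussianQ_zero : HasDerivAt gaussianQ (-(1 / Real.sqrt (2 * Real.pi))) 0 := by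
  have hc : Continuous (gaussianPDFReal 0 1) := by
    simp only [gaussianPDFReal_def]; fun_prop
  have hint := integrable_gaussianPDFReal 0 1
  have heq : gaussianQ = fun x => gaussianQ 0 - ∫ t in (0 : ℝ)..x, gaussianPDFReal 0 1 t := by
    funext x
    simp only [gaussianQ, gaussianQ_integrand_eq]
    rw [← intervalIntegral.integral_Ioi_sub_Ioi' hint.integrableOn hint.integrableOn]
    ring
  have h := (intervalIntegral.integral_hasDerivAt_right (a := 0) (b := 0)
    (hc.intervalIntegrable 0 0) (hc.stronglyMeasurableAtFilter _ _) hc.continuousAt).const_sub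
    (gaussianQ 0)
  rw [heq]
  have h0 := gaussianQ_integrand_eq 0
  simp only [neg_zero, zero_pow two_ne_zero, zero_div, Real.exp_zero, mul_one,
    one_div] at h0
  rw [one_div, h0]
  exact h

lemma measurable_real_sign : Measurable Real.sign := by
  unfold Real.sign
  exact Measurable.ite measurableSet_Iio measurable_const
    (Measurable.ite measurableSet_Ioi measurable_const measurable_const)

/-- Almost surely μ + x ≠ 0, so the sign is two-valued and the third value `Real.sign 0 = 0` carries
no mass. -/
lemma integral_comp_sign_gaussianReal {E : Type*} [NormedAddCommGroup E] [NormedSpace ℝ E]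
    [CompleteSpace E] (f : ℝ → E) (μ : ℝ) :
    ∫ x, f (Real.sign (μ + x)) ∂gaussianReal 0 1
      = gaussianQ (-μ) • f 1 + (1 - gaussianQ (-μ)) • f (-1) := by
  have hpos : ∀ x ∈ Set.Ioi (-μ), f (Real.sign (μ + x)) = f 1 := fun x (hx : -μ < x) => by
    rw [Real.sign_of_pos (by linarith)]
  have hneg : ∀ᵐ x ∂gaussianReal 0 1, x ∈ (Set.Ioi (-μ))ᶜ → f (Real.sign (μ + x)) = f (-1) := by
    have h0 : ∀ᵐ x ∂gaussianReal 0 1, x ≠ -μ := by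
      have := nullSingletonClass_gaussianReal (μ := 0) (v := 1) one_ne_zero
      exact Measure.ae_ne _ _
    filter_upwards [h0] with x hx hx'
    have : x < -μ := lt_of_le_of_ne (by simpa using hx') hx
    rw [Real.sign_of_neg (by linarith)]
  have i1 : IntegrableOn (fun x => f (Real.sign (μ + x))) (Set.Ioi (-μ)) (gaussianReal 0 1) :=
    (integrableOn_const (C := f 1) (measure_ne_top _ _)).congr_fun
      (fun x hx => (hpos x hx).symm) measurableSet_Ioi
  have i2 : IntegrableOn (fun x => f (Real.sign (μ + x))) (Set.Ioi (-μ))ᶜ (gaussianReal 0 1) := by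
    refine (integrableOn_const (C := f (-1)) (measure_ne_top _ _)).congr_fun_ae ?_
    rw [Filter.EventuallyEq, ae_restrict_iff' measurableSet_Ioi.compl]
    filter_upwards [hneg] with x hx hx' using (hx hx').symm
  rw [← setIntegral_univ, ← Set.union_compl_self (Set.Ioi (-μ)),
    setIntegral_union disjoint_compl_right measurableSet_Ioi.compl i1 i2,
    setIntegral_congr_fun measurableSet_Ioi hpos,
    setIntegral_congr_ae measurableSet_Ioi.compl hneg, setIntegral_const, setIntegral_const,
    gaussianQ_eq, probReal_compl_eq_one_sub measurableSet_Ioi]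

/-- One-bit quantization of a complex number. -/
noncomputable def oneBit (x : ℂ) : ℂ := ⟨Real.sign x.re, Real.sign x.im⟩

lemma quantize_received_apply {m n : ℕ} (Z : Matrix (Fin m) (Fin n) ℂ) (β : ℂ)
    (W : Fin m → Fin n → ℂ) (i : Fin m) (j : Fin n) :
    quantize (received Z β W) i j = oneBit (β * Z i j + W i j) := rfl

lemma measurable_oneBit : Measurable oneBit :=
  Complex.measurableEquivRealProd.symm.measurable.comp
    ((measurable_real_sign.comp Complex.measurable_re).prodMk
      (measurable_real_sign.comp Complex.measurable_im))

lemma abs_real_sign_le_one (x : ℝ) : |Real.sign x| ≤ 1 := by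
  rcases Real.sign_apply_eq x with h | h | h <;> simp [h]

lemma norm_oneBit_le (x : ℂ) : ‖oneBit x‖ ≤ 2 :=
  (Complex.norm_le_abs_re_add_abs_im _).trans (by
    have h1 := abs_real_sign_le_one x.re
    have h2 := abs_real_sign_le_one x.im
    simp only [oneBit]; linarith)

lemma memLp_inner_oneBit (a b : ℂ) (p : ENNReal) :
    MemLp (fun w => inner ℝ a (oneBit (b + w))) p complexGaussian := by
  refine MemLp.of_bound (C := ‖a‖ * 2) ?_ (ae_of_all _ fun w => ?_)
  · have := measurable_oneBit
    exact Measurable.aestronglyMeasurable (by fun_prop)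
  · exact (norm_inner_le_norm _ _).trans (by gcongr; exact norm_oneBit_le _)

lemma integral_sign_gaussianReal : ∫ x, Real.sign x ∂gaussianReal 0 1 = 0 := by
  have h := integral_comp_sign_gaussianReal (fun x : ℝ => x) 0
  simp only [zero_add, neg_zero, gaussianQ_zero] at h
  rw [h]; norm_num

lemma integral_sign_sq_gaussianReal : ∫ x, Real.sign x ^ 2 ∂gaussianReal 0 1 = 1 := by
  have h := integral_comp_sign_gaussianReal (fun x : ℝ => x ^ 2) 0
  simp only [zero_add, neg_zero, gaussianQ_zero] at h
  rw [h]; norm_num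

lemma integral_inner_oneBit (a : ℂ) : ∫ w, inner ℝ a (oneBit w) ∂complexGaussian = 0 := by
  have hre : ∫ w, (oneBit w).re ∂complexGaussian = 0 := by
    simpa [integral_sign_gaussianReal, oneBit] using integral_complexGaussian_mul Real.sign fun _ => 1
  have him : ∫ w, (oneBit w).im ∂complexGaussian = 0 := by
    simpa [integral_sign_gaussianReal, oneBit] using integral_complexGaussian_mul (fun _ => 1) Real.sign
  -- Testing against the directions 1 and i recovers the real and imaginary parts.
  have h1 := (memLp_inner_oneBit 1 0 1).integrable le_rfl
  have h2 := (memLp_inner_oneBit Complex.I 0 1).integrable le_rfl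
  simp only [inner_eq_re_mul_add_im_mul, zero_add, Complex.one_re, Complex.one_im, Complex.I_re,
    Complex.I_im, one_mul, zero_mul, add_zero] at h1 h2
  simp only [inner_eq_re_mul_add_im_mul]
  rw [integral_add (h1.const_mul _) (h2.const_mul _), integral_const_mul, integral_const_mul, hre,
    him]
  simp

/-- The two sign components are uncorrelated with unit second moment, so the covariance form is the
Euclidean one. -/
lemma integral_inner_oneBit_mul (a b : ℂ) :
    ∫ w, inner ℝ a (oneBit w) * inner ℝ b (oneBit w) ∂complexGaussian = inner ℝ a b := by
  have hrr : ∫ w, (oneBit w).re * (oneBit w).re ∂complexGaussian = 1 := by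
    simpa [← sq, oneBit] using
      (integral_complexGaussian_mul (fun x => Real.sign x ^ 2) fun _ => 1).trans
        (by simp [integral_sign_sq_gaussianReal])
  have hii : ∫ w, (oneBit w).im * (oneBit w).im ∂complexGaussian = 1 := by
    simpa [← sq, oneBit] using
      (integral_complexGaussian_mul (fun _ => 1) (fun x => Real.sign x ^ 2)).trans
        (by simp [integral_sign_sq_gaussianReal])
  have hri : ∫ w, (oneBit w).re * (oneBit w).im ∂complexGaussian = 0 := by
    simpa [integral_sign_gaussianReal, oneBit] using integral_complexGaussian_mul Real.sign Real.sign
  have h1 := memLp_inner_oneBit 1 0 2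
  have h2 := memLp_inner_oneBit Complex.I 0 2
  simp only [inner_eq_re_mul_add_im_mul, zero_add, Complex.one_re, Complex.one_im, Complex.I_re,
    Complex.I_im, one_mul, zero_mul, add_zero] at h1 h2
  have i11 : Integrable (fun w => (oneBit w).re * (oneBit w).re) complexGaussian :=
    h1.integrable_mul h1
  have i12 : Integrable (fun w => (oneBit w).re * (oneBit w).im) complexGaussian :=
    h1.integrable_mul h2
  have i22 : Integrable (fun w => (oneBit w).im * (oneBit w).im) complexGaussian :=
    h2.integrable_mul h2
  have heq : ∀ w, inner ℝ a (oneBit w) * inner ℝ b (oneBit w)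
      = a.re * b.re * ((oneBit w).re * (oneBit w).re)
        + (a.re * b.im + a.im * b.re) * ((oneBit w).re * (oneBit w).im)
        + a.im * b.im * ((oneBit w).im * (oneBit w).im) := fun w => by
    simp only [inner_eq_re_mul_add_im_mul]; ring
  simp only [heq]
  have i3 := (i11.const_mul (a.re * b.re)).add (i12.const_mul (a.re * b.im + a.im * b.re))
  simp only [Pi.add_def] at i3
  rw [integral_add i3 (i22.const_mul _), integral_add (i11.const_mul _) (i12.const_mul _), integral_const_mul, integral_const_mul,
    integral_const_mul, hrr, hri, hii, inner_eq_re_mul_add_im_mul]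
  ring

/-- The summands are centred and independent across entries, so only diagonal terms survive. This
computes the Fisher matrix. -/
lemma integral_sum_inner_oneBit_mul {m n : ℕ} (a b : Fin m × Fin n → ℂ) :
    ∫ W, (∑ q, inner ℝ (a q) (oneBit (W q.1 q.2))) * (∑ q, inner ℝ (b q) (oneBit (W q.1 q.2)))
      ∂noiseLaw m n = ∑ q, inner ℝ (a q) (b q) := by
  have hL : ∀ (a : Fin m × Fin n → ℂ) q,
      MemLp (fun W : Fin m → Fin n → ℂ => inner ℝ (a q) (oneBit (W q.1 q.2))) 2 (noiseLaw m n) := by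
    intro a q
    have := (memLp_inner_oneBit (a q) 0 2).comp_measurePreserving (measurePreserving_noise_entry q)
    simpa only [Function.comp_def, zero_add] using this
  have hm : ∀ a : ℂ, Measurable fun w => inner ℝ a (oneBit w) := fun a => by
    have := measurable_oneBit
    fun_prop
  have h0 : ∀ (a : Fin m × Fin n → ℂ) q,
      ∫ W, inner ℝ (a q) (oneBit (W q.1 q.2)) ∂noiseLaw m n = 0 := fun a q => by
    rw [integral_noise_entry q (f := fun w => inner ℝ (a q) (oneBit w))
      (hm _).aestronglyMeasurable, integral_inner_oneBit]
  have h0s : ∀ a : Fin m × Fin n → ℂ,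
      ∫ W, ∑ q, inner ℝ (a q) (oneBit (W q.1 q.2)) ∂noiseLaw m n = 0 := fun a => by
    rw [integral_finsetSum _ fun q _ => (hL a q).integrable one_le_two]
    exact Finset.sum_eq_zero fun q _ => h0 a q
  have hcov := covariance_fun_sum_fun_sum (μ := noiseLaw m n) (hL a) (hL b)
  rw [covariance_eq_sub (memLp_finsetSum _ fun q _ => hL a q)
    (memLp_finsetSum _ fun q _ => hL b q), h0s, h0s, mul_zero, sub_zero] at hcov
  refine Eq.trans hcov (Finset.sum_congr rfl fun q _ => ?_)
  rw [Finset.sum_eq_single q]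
  · rw [covariance_eq_sub (hL a q) (hL b q), h0, zero_mul, sub_zero]
    exact (integral_noise_entry q (f := fun w => inner ℝ (a q) (oneBit w) * inner ℝ (b q) (oneBit w))
      ((hm _).mul (hm _)).aestronglyMeasurable).trans (integral_inner_oneBit_mul _ _)
  · intro q' _ hq'
    exact (((iIndepFun_noise_entry m n).indepFun hq'.symm).comp (hm (a q)) (hm (b q'))).covariance_eq_zero
      (hL a q) (hL b q')
  · simp

/-! ### Score, Fisher information and Rao's statistic at zero. -/

/-- The unit directions `1` and `i` in which the reflectivity parameters move. -/
noncomputable def paramDir (k : Fin 2) : ℂ := if k = 0 then 1 else Complex.I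

lemma reflectivity_update_zero (k : Fin 2) (t : ℝ) :
    reflectivity (Function.update 0 k t) = t * paramDir k := by
  fin_cases k <;> simp [reflectivity, paramDir, Complex.ext_iff]

/-- At 0 the logarithmic derivative of Q is -2/√(2π), since Q(0) = 1/2; every summand of the
likelihood is therefore linearized with the same constant. -/
lemma score_zero_apply {m n : ℕ} (Z Y : Matrix (Fin m) (Fin n) ℂ) (k : Fin 2) :
    score Z Y 0 k = 2 / Real.sqrt (2 * Real.pi) *
      ∑ q : Fin m × Fin n, inner ℝ (paramDir k * Z q.1 q.2) (Y q.1 q.2) := by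
  have key : ∀ y c : ℝ, HasDerivAt (fun t : ℝ => Real.log (gaussianQ (-y * (t * c))))
      (2 / Real.sqrt (2 * Real.pi) * (c * y)) 0 := by
    intro y c
    have h1 : HasDerivAt (fun t : ℝ => -y * (t * c)) (-y * c) 0 := by
      simpa using ((hasDerivAt_id (0 : ℝ)).mul_const c).const_mul (-y)
    have h2 : HasDerivAt gaussianQ (-(1 / Real.sqrt (2 * Real.pi))) (-y * (0 * c)) := by
      simpa using hasDerivAt_gaussianQ_zero
    have h3 := (h2.comp (0 : ℝ) h1).log (by simp [gaussianQ_zero])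
    refine h3.congr_deriv ?_
    have hq : (gaussianQ ∘ fun t : ℝ => -y * (t * c)) 0 = 1 / 2 := by simp [gaussianQ_zero]
    rw [hq]
    ring
  have hre : ∀ (t : ℝ) (z : ℂ), (t * paramDir k * z).re = t * (paramDir k * z).re := fun t z => by
    rw [mul_assoc, Complex.re_ofReal_mul]
  have him : ∀ (t : ℝ) (z : ℂ), (t * paramDir k * z).im = t * (paramDir k * z).im := fun t z => by
    rw [mul_assoc, Complex.im_ofReal_mul]
  have hL : (fun t : ℝ => logLikelihood Z Y (Function.update 0 k t)) = fun t =>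
      (∑ i, ∑ j, Real.log (gaussianQ (-(Y i j).re * (t * (paramDir k * Z i j).re)))) +
        ∑ i, ∑ j, Real.log (gaussianQ (-(Y i j).im * (t * (paramDir k * Z i j).im))) := by
    simp only [logLikelihood, reflectivity_update_zero, hre, him]
  have h := (HasDerivAt.fun_sum (u := Finset.univ) fun i _ => HasDerivAt.fun_sum
      (u := Finset.univ) fun j _ => key (Y i j).re (paramDir k * Z i j).re).fun_add
    (HasDerivAt.fun_sum (u := Finset.univ) fun i _ => HasDerivAt.fun_sum
      (u := Finset.univ) fun j _ => key (Y i j).im (paramDir k * Z i j).im)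
  rw [score, Pi.zero_apply, hL, h.deriv]
  simp only [Fintype.sum_prod_type, inner_eq_re_mul_add_im_mul, Finset.mul_sum, mul_add,
    Finset.sum_add_distrib]

lemma reflectivity_zero : reflectivity 0 = 0 := rfl

/-- The off-diagonal entries vanish because z and iz are orthogonal in the real inner product. -/
lemma fisherInformation_zero {m n : ℕ} (Z : Matrix (Fin m) (Fin n) ℂ) :
    fisherInformation Z 0 = (2 / Real.pi * ∑ q : Fin m × Fin n, ‖Z q.1 q.2‖ ^ 2) • 1 := by
  have hc : 2 / Real.sqrt (2 * Real.pi) * (2 / Real.sqrt (2 * Real.pi)) = 2 / Real.pi := by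
    rw [div_mul_div_comm, Real.mul_self_sqrt (by positivity)]
    field_simp
  ext k l
  simp only [fisherInformation, Matrix.of_apply, score_zero_apply, reflectivity_zero,
    quantize_received_apply, zero_mul, zero_add, mul_mul_mul_comm (2 / Real.sqrt (2 * Real.pi)), hc]
  rw [integral_const_mul, integral_sum_inner_oneBit_mul (fun q => paramDir k * Z q.1 q.2)
    (fun q => paramDir l * Z q.1 q.2), Matrix.smul_apply, smul_eq_mul, mul_assoc]
  congr 1
  rw [Finset.sum_mul]
  refine Finset.sum_congr rfl fun q _ => ?_
  rw [inner_eq_re_mul_add_im_mul, Complex.sq_norm, Complex.normSq_apply]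
  fin_cases k <;> fin_cases l <;> simp [paramDir] <;> ring

/-- The matched-filter output `tr (Zᴴ Y) / √(mn)`. -/
noncomputable def matchedFilter {m n : ℕ} (Z Y : Matrix (Fin m) (Fin n) ℂ) : ℂ :=
  ∑ q : Fin m × Fin n, ((Real.sqrt (m * n : ℕ))⁻¹ : ℝ) • (star (Z q.1 q.2) * Y q.1 q.2)

lemma raoStatistic_eq {m n : ℕ} {Z : Matrix (Fin m) (Fin n) ℂ} (Y : Matrix (Fin m) (Fin n) ℂ)
    (hZ : ∑ q : Fin m × Fin n, ‖Z q.1 q.2‖ ^ 2 = (m * n : ℕ)) (hN : 0 < m * n) :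
    raoStatistic Z Y = ‖matchedFilter Z Y‖ ^ 2 := by
  have hN' : (0 : ℝ) < (m * n : ℕ) := by exact_mod_cast hN
  set N : ℝ := ((m * n : ℕ) : ℝ)
  have hF : fisherInformation Z 0 = Matrix.diagonal fun _ => 2 / Real.pi * N := by
    rw [fisherInformation_zero, hZ, Matrix.smul_one_eq_diagonal]
  have hinv : (fisherInformation Z 0)⁻¹ = (2 / Real.pi * N)⁻¹ • 1 := by
    refine Matrix.inv_eq_left_inv ?_
    rw [hF, ← Matrix.smul_one_eq_diagonal, smul_mul_smul_comm, inv_mul_cancel₀ (by positivity)]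
    simp
  have hre : (matchedFilter Z Y).re =
      (Real.sqrt N)⁻¹ * ∑ q : Fin m × Fin n, inner ℝ (paramDir 0 * Z q.1 q.2) (Y q.1 q.2) := by
    simp only [matchedFilter, Complex.re_sum, Finset.mul_sum]
    refine Finset.sum_congr rfl fun q _ => ?_
    rw [inner_eq_re_mul_add_im_mul, Complex.smul_re, smul_eq_mul]
    congr 1
    simp [paramDir]
  have him : (matchedFilter Z Y).im =
      (Real.sqrt N)⁻¹ * ∑ q : Fin m × Fin n, inner ℝ (paramDir 1 * Z q.1 q.2) (Y q.1 q.2) := by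
    simp only [matchedFilter, Complex.im_sum, Finset.mul_sum]
    refine Finset.sum_congr rfl fun q _ => ?_
    rw [inner_eq_re_mul_add_im_mul, Complex.smul_im, smul_eq_mul]
    congr 1
    simp [paramDir]
    ring
  rw [raoStatistic, hinv, Complex.sq_norm, Complex.normSq_apply, hre, him]
  rw [Matrix.smul_mulVec, Matrix.one_mulVec, dotProduct_smul, smul_eq_mul]
  simp only [dotProduct, Fin.sum_univ_two, score_zero_apply]
  generalize (∑ q : Fin m × Fin n, inner ℝ (paramDir 0 * Z q.1 q.2) (Y q.1 q.2)) = A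
  generalize (∑ q : Fin m × Fin n, inner ℝ (paramDir 1 * Z q.1 q.2) (Y q.1 q.2)) = B
  have h1 : (Real.sqrt N)⁻¹ ^ 2 = N⁻¹ := by rw [inv_pow, Real.sq_sqrt hN'.le]
  have h2 : (2 / Real.sqrt (2 * Real.pi)) ^ 2 = 2 / Real.pi := by
    rw [div_pow, Real.sq_sqrt (by positivity)]; field_simp
  calc _ = (2 / Real.pi * N)⁻¹ * ((2 / Real.sqrt (2 * Real.pi)) ^ 2 * (A ^ 2 + B ^ 2)) := by ring
    _ = (Real.sqrt N)⁻¹ ^ 2 * (A ^ 2 + B ^ 2) := by rw [h1, h2]; field_simp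
    _ = _ := by ring

/-! ### Characteristic functions of matched-filter outputs. -/

lemma norm_prod_sub_prod_le {ι : Type*} (s : Finset ι) {a b : ι → ℂ} (ha : ∀ i ∈ s, ‖a i‖ ≤ 1)
    (hb : ∀ i ∈ s, ‖b i‖ ≤ 1) : ‖∏ i ∈ s, a i - ∏ i ∈ s, b i‖ ≤ ∑ i ∈ s, ‖a i - b i‖ := by
  classical
  induction s using Finset.induction_on with
  | empty => simp
  | insert i s hi ih =>
    rw [Finset.prod_insert hi, Finset.prod_insert hi, Finset.sum_insert hi]
    have h1 : ‖∏ j ∈ s, a j‖ ≤ 1 := by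
      rw [norm_prod]
      exact Finset.prod_le_one (fun _ _ => norm_nonneg _)
        fun j hj => ha j (Finset.mem_insert_of_mem hj)
    have h2 := ih (fun j hj => ha j (Finset.mem_insert_of_mem hj))
      (fun j hj => hb j (Finset.mem_insert_of_mem hj))
    have h3 := hb i (Finset.mem_insert_self i s)
    calc ‖a i * ∏ j ∈ s, a j - b i * ∏ j ∈ s, b j‖
        = ‖(a i - b i) * ∏ j ∈ s, a j + b i * (∏ j ∈ s, a j - ∏ j ∈ s, b j)‖ := by
          congr 1; ring
      _ ≤ ‖a i - b i‖ * 1 + 1 * ‖∏ j ∈ s, a j - ∏ j ∈ s, b j‖ := by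
          refine (norm_add_le _ _).trans ?_
          rw [norm_mul, norm_mul]
          gcongr
      _ ≤ _ := by linarith

/-- Scaled matched-filter weights. -/
noncomputable def filterWeight {m n : ℕ} (Z : Matrix (Fin m) (Fin n) ℂ) (t : ℂ)
    (q : Fin m × Fin n) : ℂ :=
  ((Real.sqrt (m * n : ℕ))⁻¹ : ℝ) • (Z q.1 q.2 * t)

lemma measurable_matchedFilter {m n : ℕ} (Z : Matrix (Fin m) (Fin n) ℂ)
    {f : Fin m × Fin n → ℂ → ℂ} (hf : ∀ q, Measurable (f q)) :
    Measurable fun W : Fin m → Fin n → ℂ =>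
      matchedFilter Z (Matrix.of fun i j => f (i, j) (W i j)) := by
  unfold matchedFilter
  refine Finset.measurable_fun_sum _ fun q _ => ?_
  have := (hf q).comp (measurePreserving_noise_entry q).measurable
  simp only [Function.comp_def] at this
  simp only [Matrix.of_apply]
  fun_prop

/-- Independence gives the product, and moving the conjugate of z across the inner product turns t
into the weight zt/√N. The map f covers both raw and quantized data. -/
lemma charFun_matchedFilter {m n : ℕ} (Z : Matrix (Fin m) (Fin n) ℂ)
    {f : Fin m × Fin n → ℂ → ℂ} (hf : ∀ q, Measurable (f q)) (t : ℂ) :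
    charFun ((noiseLaw m n).map fun W =>
        matchedFilter Z (Matrix.of fun i j => f (i, j) (W i j))) t
      = ∏ q, ∫ w, Complex.exp ((inner ℝ (f q w) (filterWeight Z t q) : ℝ) * Complex.I)
          ∂complexGaussian := by
  set c : ℝ := (Real.sqrt (m * n : ℕ))⁻¹ with hc
  let g : Fin m × Fin n → ℂ → ℂ := fun q w => c • (star (Z q.1 q.2) * f q w)
  have hg : ∀ q, Measurable (g q) := fun q => by
    have := hf q
    simp only [g]
    fun_prop
  have hgW : ∀ q, Measurable fun W : Fin m → Fin n → ℂ => g q (W q.1 q.2) := fun q =>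
    (hg q).comp (measurePreserving_noise_entry q).measurable
  have hind : iIndepFun (fun q (W : Fin m → Fin n → ℂ) => g q (W q.1 q.2)) (noiseLaw m n) :=
    (iIndepFun_noise_entry m n).comp g hg
  have h := congrFun (hind.charFun_map_fun_sum_eq_prod fun q => (hgW q).aemeasurable) t
  rw [Finset.prod_apply] at h
  refine Eq.trans h (Finset.prod_congr rfl fun q _ => ?_)
  rw [charFun_apply, integral_map (hgW q).aemeasurable (by fun_prop)]
  have hmeas : Measurable fun w => Complex.exp ((inner ℝ (g q w) t : ℝ) * Complex.I) := by
    have := hg q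
    fun_prop
  rw [integral_noise_entry q (f := fun w => Complex.exp ((inner ℝ (g q w) t : ℝ) * Complex.I))
    hmeas.aestronglyMeasurable]
  congr with w
  congr 3
  simp only [g, filterWeight, inner_eq_re_mul_add_im_mul, Complex.smul_re, Complex.smul_im,
    smul_eq_mul, Complex.mul_re, Complex.mul_im, Complex.star_def, Complex.conj_re,
    Complex.conj_im, ← hc]
  ring

section Weights

variable {m n : ℕ} {Z : Matrix (Fin m) (Fin n) ℂ}

lemma norm_filterWeight_sq (t : ℂ) (q : Fin m × Fin n) :
    ‖filterWeight Z t q‖ ^ 2 = ((m * n : ℕ) : ℝ)⁻¹ * (‖Z q.1 q.2‖ ^ 2 * ‖t‖ ^ 2) := by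
  rw [filterWeight, norm_smul, norm_mul, mul_pow, mul_pow, Real.norm_eq_abs, sq_abs, inv_pow,
    Real.sq_sqrt (Nat.cast_nonneg _)]

lemma sum_norm_filterWeight_sq (hZ : ∑ q : Fin m × Fin n, ‖Z q.1 q.2‖ ^ 2 = (m * n : ℕ))
    (hN : 0 < m * n) (t : ℂ) : ∑ q, ‖filterWeight Z t q‖ ^ 2 = ‖t‖ ^ 2 := by
  have hN' : ((m * n : ℕ) : ℝ) ≠ 0 := by exact_mod_cast hN.ne'
  simp only [norm_filterWeight_sq]
  rw [← Finset.mul_sum, ← Finset.sum_mul, hZ, inv_mul_cancel_left₀ hN']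

lemma sum_inner_filterWeight (hZ : ∑ q : Fin m × Fin n, ‖Z q.1 q.2‖ ^ 2 = (m * n : ℕ))
    (hN : 0 < m * n) (β t : ℂ) : ∑ q, inner ℝ (β * Z q.1 q.2) (filterWeight Z t q)
      = Real.sqrt (m * n : ℕ) * inner ℝ β t := by
  have hN' : (0 : ℝ) < ((m * n : ℕ) : ℝ) := by exact_mod_cast hN
  have h : ∀ q, inner ℝ (β * Z q.1 q.2) (filterWeight Z t q)
      = (Real.sqrt (m * n : ℕ))⁻¹ * inner ℝ β t * ‖Z q.1 q.2‖ ^ 2 := fun q => by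
    simp only [filterWeight, inner_eq_re_mul_add_im_mul, Complex.smul_re, Complex.smul_im,
      smul_eq_mul, Complex.mul_re, Complex.mul_im, Complex.sq_norm, Complex.normSq_apply]
    ring
  simp only [h]
  rw [← Finset.mul_sum, hZ]
  have h1 : Real.sqrt ((m * n : ℕ) : ℝ) * Real.sqrt ((m * n : ℕ) : ℝ) = ((m * n : ℕ) : ℝ) :=
    Real.mul_self_sqrt hN'.le
  have h2 : Real.sqrt ((m * n : ℕ) : ℝ) ≠ 0 := by positivity
  generalize Real.sqrt ((m * n : ℕ) : ℝ) = s at *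
  rw [← h1]
  field_simp

end Weights

lemma norm_integral_exp_inner_le (f : ℂ → ℂ) (u : ℂ) :
    ‖∫ w, Complex.exp ((inner ℝ (f w) u : ℝ) * Complex.I) ∂complexGaussian‖ ≤ 1 := by
  refine (norm_integral_le_integral_norm _).trans ?_
  simp only [Complex.norm_exp_ofReal_mul_I]
  simp

/-! ### Local Gaussian approximation of a single quantized entry. -/

/-- Characteristic function of the sign of a unit Gaussian with mean `μ`. -/
noncomputable def signCharFun (s μ : ℝ) : ℂ :=
  Real.cos s + (2 * gaussianQ (-μ) - 1) * Real.sin s * Complex.I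

lemma integral_exp_sign (s μ : ℝ) :
    ∫ x, Complex.exp ((Real.sign (μ + x) * s : ℝ) * Complex.I) ∂gaussianReal 0 1
      = signCharFun s μ := by
  rw [integral_comp_sign_gaussianReal (fun y => Complex.exp ((y * s : ℝ) * Complex.I)) μ,
    Complex.exp_mul_I, Complex.exp_mul_I, signCharFun]
  simp only [one_mul, neg_mul, Complex.ofReal_neg, Complex.cos_neg, Complex.sin_neg,
    Complex.real_smul, Complex.ofReal_sub, Complex.ofReal_one, Complex.ofReal_cos,
    Complex.ofReal_sin]
  ring

lemma integral_exp_inner_oneBit (b u : ℂ) :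
    ∫ w, Complex.exp ((inner ℝ (oneBit (b + w)) u : ℝ) * Complex.I) ∂complexGaussian
      = signCharFun u.re b.re * signCharFun u.im b.im := by
  simp only [exp_inner_mul_I]
  rw [← integral_exp_sign, ← integral_exp_sign, ← integral_complexGaussian_mul]
  rfl

lemma norm_signCharFun_le (s μ : ℝ) : ‖signCharFun s μ‖ ≤ 1 := by
  rw [← integral_exp_sign]
  refine (norm_integral_le_integral_norm _).trans ?_
  simp only [Complex.norm_exp_ofReal_mul_I]
  simp

/-- The mean of the sign of a unit Gaussian with mean `μ` is `signGain * μ` to first order. -/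
noncomputable def signGain : ℝ := 2 / Real.sqrt (2 * Real.pi)

lemma signGain_sq : signGain ^ 2 = 2 / Real.pi := by
  rw [signGain, div_pow, Real.sq_sqrt (by positivity)]; field_simp

lemma signGain_nonneg : 0 ≤ signGain := by unfold signGain; positivity

lemma signGain_le_one : signGain ≤ 1 := by
  rw [← sq_le_one_iff₀ signGain_nonneg, signGain_sq, div_le_one Real.pi_pos]
  linarith [Real.pi_gt_three]

lemma exists_abs_mean_sign_sub_le {ε : ℝ} (hε : 0 < ε) :
    ∃ δ > 0, ∀ μ : ℝ, |μ| ≤ δ → |2 * gaussianQ (-μ) - 1 - signGain * μ| ≤ ε * |μ| := by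
  have h1 : HasDerivAt (fun μ : ℝ => 2 * gaussianQ (-μ) - 1) signGain 0 := by
    have h2 : HasDerivAt gaussianQ (-(1 / Real.sqrt (2 * Real.pi))) (-0) := by
      simpa using hasDerivAt_gaussianQ_zero
    refine (((h2.comp (0 : ℝ) (hasDerivAt_neg 0)).const_mul 2).sub_const 1).congr_deriv ?_
    rw [signGain]; ring
  rw [hasDerivAt_iff_isLittleO] at h1
  obtain ⟨δ, hδ, h⟩ := Metric.eventually_nhds_iff.1 (h1.def hε)
  refine ⟨δ / 2, by positivity, fun μ hμ => ?_⟩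
  have := @h μ (by rw [Real.dist_eq, sub_zero]; linarith)
  simp only [neg_zero, gaussianQ_zero, sub_zero, smul_eq_mul, Real.norm_eq_abs] at this
  convert this using 2
  ring

/-- With g the gain, both sides are 1 - s²/2 + i g μ s plus errors that are o(s² + μ²): the mean of
the sign is g μ + o(μ), and the remaining terms are of fourth order. -/
lemma exists_norm_signCharFun_sub_le {ε : ℝ} (hε : 0 < ε) :
    ∃ δ > 0, ∀ s μ : ℝ, |s| ≤ δ → |μ| ≤ δ →
      ‖signCharFun s μ - Complex.exp ((signGain * (μ * s) : ℝ) * Complex.I - (s ^ 2 / 2 : ℝ))‖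
        ≤ ε * (s ^ 2 + μ ^ 2) := by
  obtain ⟨δ₀, hδ₀, hr⟩ := exists_abs_mean_sign_sub_le (half_pos hε)
  -- The bound 1/2 gives R ≤ (|s| + |μ|)/2, and then ε/12 gives R ≤ ε/12, so the three final terms
  -- R·R cost at most εR/4. The mean expansion costs another εR/4.
  refine ⟨min (min δ₀ (1 / 2)) (ε / 12), by positivity, fun s μ hs hμ => ?_⟩
  simp only [le_min_iff] at hs hμ
  set r : ℝ := 2 * gaussianQ (-μ) - 1 with hr_def
  set R : ℝ := s ^ 2 + μ ^ 2 with hR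
  set z : ℂ := (signGain * (μ * s) : ℝ) * Complex.I - (s ^ 2 / 2 : ℝ) with hz
  have hR0 : 0 ≤ R := by positivity
  have hs2 : |s| ^ 2 = s ^ 2 := sq_abs s
  have hm2 : |μ| ^ 2 = μ ^ 2 := sq_abs μ
  have hs0 := abs_nonneg s
  have hm0 := abs_nonneg μ
  have hprod : |μ| * |s| ≤ R / 2 := by nlinarith [sq_nonneg (|μ| - |s|)]
  have hs3 : |s| ^ 2 ≤ |s| * (1 / 2) := by rw [sq]; gcongr; exact hs.1.2
  have hm3 : |μ| ^ 2 ≤ |μ| * (1 / 2) := by rw [sq]; gcongr; exact hμ.1.2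
  have hR1 : R ≤ 1 / 2 := by linarith
  have hR2 : R ≤ ε / 12 := by linarith
  have hsR : |s| ^ 2 ≤ R := by rw [hs2, hR]; linarith [sq_nonneg μ]
  have hzR : ‖z‖ ≤ R := by
    calc ‖z‖ ≤ ‖((signGain * (μ * s) : ℝ) : ℂ) * Complex.I‖ + ‖((s ^ 2 / 2 : ℝ) : ℂ)‖ :=
          norm_sub_le _ _
      _ = signGain * (|μ| * |s|) + s ^ 2 / 2 := by
          rw [norm_mul, Complex.norm_I, mul_one, Complex.norm_real, Complex.norm_real,
            Real.norm_eq_abs, Real.norm_eq_abs, abs_mul, abs_mul, abs_of_nonneg signGain_nonneg,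
            abs_of_nonneg (by positivity : 0 ≤ s ^ 2 / 2)]
      _ ≤ 1 * (|μ| * |s|) + s ^ 2 / 2 := by gcongr; exact signGain_le_one
      _ ≤ R := by linarith [sq_nonneg μ]
  have hexp := Complex.norm_exp_sub_one_sub_id_le (x := z) (by linarith)
  have hcos := Real.cos_bound (x := s) (by linarith)
  have hsin : |Real.sin s - s| ≤ |s| ^ 3 := by
    have h1 := Real.sin_bound (x := s) (by linarith)
    have h2 : Real.sin s - s = (Real.sin s - (s - s ^ 3 / 6)) + -(s ^ 3 / 6) := by ring
    have h4 : |s| ^ 5 ≤ |s| ^ 3 := pow_le_pow_of_le_one hs0 (by linarith) (by norm_num)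
    calc |Real.sin s - s| ≤ |Real.sin s - (s - s ^ 3 / 6)| + |-(s ^ 3 / 6)| := by
          rw [h2]; exact abs_add_le _ _
      _ ≤ |s| ^ 5 / 100 + |s| ^ 3 / 6 := by
          refine add_le_add h1 (le_of_eq ?_)
          rw [abs_neg, abs_div, abs_pow]; norm_num
      _ ≤ _ := by linarith [pow_nonneg hs0 3]
  have hdecomp : signCharFun s μ - Complex.exp z =
      ((Real.cos s - (1 - s ^ 2 / 2) : ℝ) : ℂ)
        + ((r - signGain * μ) * Real.sin s + signGain * μ * (Real.sin s - s) : ℝ) * Complex.I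
        - (Complex.exp z - 1 - z) := by
    rw [signCharFun, hz, hr_def]; push_cast; ring
  have hmid : |(r - signGain * μ) * Real.sin s + signGain * μ * (Real.sin s - s)|
      ≤ ε / 2 * (|μ| * |s|) + |μ| * |s| ^ 3 := by
    refine (abs_add_le _ _).trans (add_le_add ?_ ?_)
    · rw [abs_mul, ← mul_assoc]
      exact mul_le_mul (hr μ hμ.1.1) Real.abs_sin_le_abs (abs_nonneg _) (by positivity)
    · rw [abs_mul, abs_mul, abs_of_nonneg signGain_nonneg]
      refine mul_le_mul ?_ hsin (abs_nonneg _) hm0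
      exact mul_le_of_le_one_left hm0 signGain_le_one
  have h1 : |s| ^ 4 ≤ R * R :=
    calc |s| ^ 4 = |s| ^ 2 * |s| ^ 2 := by ring
      _ ≤ R * R := by gcongr
  have h2 : |μ| * |s| ^ 3 ≤ R * R :=
    calc |μ| * |s| ^ 3 = (|μ| * |s|) * |s| ^ 2 := by ring
      _ ≤ R * R := by gcongr; linarith
  have h3 : ‖z‖ ^ 2 ≤ R * R := by rw [sq]; gcongr
  calc ‖signCharFun s μ - Complex.exp z‖
      ≤ |Real.cos s - (1 - s ^ 2 / 2)|
        + |(r - signGain * μ) * Real.sin s + signGain * μ * (Real.sin s - s)|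
        + ‖Complex.exp z - 1 - z‖ := by
        rw [hdecomp]
        refine (norm_sub_le _ _).trans (add_le_add_left ((norm_add_le _ _).trans ?_) _)
        rw [norm_mul, Complex.norm_I, mul_one, Complex.norm_real, Complex.norm_real,
          Real.norm_eq_abs, Real.norm_eq_abs]
    _ ≤ |s| ^ 4 * (5 / 96) + (ε / 2 * (|μ| * |s|) + |μ| * |s| ^ 3) + ‖z‖ ^ 2 := by gcongr
    _ ≤ R * R + (ε / 2 * (R / 2) + R * R) + R * R := by
        have h4 : |s| ^ 4 * (5 / 96) ≤ R * R := by linarith [pow_nonneg hs0 4]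
        gcongr
    _ ≤ ε * R := by linarith [mul_le_mul_of_nonneg_right hR2 hR0, mul_nonneg hε.le hR0]

lemma exists_norm_integral_exp_inner_oneBit_sub_le {ε : ℝ} (hε : 0 < ε) :
    ∃ δ > 0, ∀ b u : ℂ, ‖b‖ ≤ δ → ‖u‖ ≤ δ →
      ‖∫ w, Complex.exp ((inner ℝ (oneBit (b + w)) u : ℝ) * Complex.I) ∂complexGaussian
        - Complex.exp ((signGain * inner ℝ b u : ℝ) * Complex.I - (‖u‖ ^ 2 / 2 : ℝ))‖
        ≤ ε * (‖u‖ ^ 2 + ‖b‖ ^ 2) := by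
  obtain ⟨δ, hδ, h⟩ := exists_norm_signCharFun_sub_le hε
  refine ⟨δ, hδ, fun b u hb hu => ?_⟩
  have h1 := h u.re b.re ((Complex.abs_re_le_norm _).trans hu) ((Complex.abs_re_le_norm _).trans hb)
  have h2 := h u.im b.im ((Complex.abs_im_le_norm _).trans hu) ((Complex.abs_im_le_norm _).trans hb)
  have he : ∀ x s : ℝ, ‖Complex.exp ((x : ℝ) * Complex.I - (s ^ 2 / 2 : ℝ))‖ ≤ 1 := by
    intro x s
    rw [Complex.norm_exp, Real.exp_le_one_iff]
    simp only [Complex.sub_re, Complex.re_ofReal_mul, Complex.I_re, mul_zero, Complex.ofReal_re]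
    linarith [sq_nonneg s]
  have hsplit : Complex.exp ((signGain * inner ℝ b u : ℝ) * Complex.I - (‖u‖ ^ 2 / 2 : ℝ))
      = Complex.exp ((signGain * (b.re * u.re) : ℝ) * Complex.I - (u.re ^ 2 / 2 : ℝ))
        * Complex.exp ((signGain * (b.im * u.im) : ℝ) * Complex.I - (u.im ^ 2 / 2 : ℝ)) := by
    rw [← Complex.exp_add, inner_eq_re_mul_add_im_mul, Complex.sq_norm, Complex.normSq_apply]
    congr 1; push_cast; ring
  rw [integral_exp_inner_oneBit, hsplit]
  have h3 := norm_prod_sub_prod_le (Finset.univ : Finset (Fin 2))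
    (a := ![signCharFun u.re b.re, signCharFun u.im b.im])
    (b := ![Complex.exp ((signGain * (b.re * u.re) : ℝ) * Complex.I - (u.re ^ 2 / 2 : ℝ)),
      Complex.exp ((signGain * (b.im * u.im) : ℝ) * Complex.I - (u.im ^ 2 / 2 : ℝ))])
    (fun i _ => by fin_cases i <;> exact norm_signCharFun_le _ _)
    (fun i _ => by fin_cases i <;> exact he _ _)
  simp only [Fin.prod_univ_two, Fin.sum_univ_two, Matrix.cons_val_zero, Matrix.cons_val_one] at h3
  refine h3.trans ((add_le_add h1 h2).trans_eq ?_)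
  rw [Complex.sq_norm, Complex.sq_norm, Complex.normSq_apply, Complex.normSq_apply]
  ring

/-! ### Asymptotic law of Rao's statistic. -/

lemma AsympEq.congr {F F' G G' : ℕ → ℝ → ℝ} (h : AsympEq F G)
    (hF : ∀ᶠ n in atTop, F n = F' n) (hG : ∀ᶠ n in atTop, G n = G' n) : AsympEq F' G' := by
  intro ε hε
  filter_upwards [h ε hε, hF, hG] with n hn h1 h2
  rwa [← h1, ← h2]

/-- Law of the matched-filter output computed from one-bit data. -/
noncomputable def oneBitFilterLaw {m n : ℕ} (Z : Matrix (Fin m) (Fin n) ℂ) (β : ℂ) : Measure ℂ :=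
  (noiseLaw m n).map fun W => matchedFilter Z (quantize (received Z β W))

lemma measurable_oneBit_add (b : ℂ) : Measurable fun w => oneBit (b + w) := by
  have := measurable_oneBit
  fun_prop

lemma measurable_matchedFilter_quantize {m n : ℕ} (Z : Matrix (Fin m) (Fin n) ℂ) (β : ℂ) :
    Measurable fun W => matchedFilter Z (quantize (received Z β W)) :=
  measurable_matchedFilter Z (f := fun q w => oneBit (β * Z q.1 q.2 + w))
    fun _ => measurable_oneBit_add _

instance {m n : ℕ} (Z : Matrix (Fin m) (Fin n) ℂ) (β : ℂ) :
    IsProbabilityMeasure (oneBitFilterLaw Z β) :=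
  Measure.isProbabilityMeasure_map (measurable_matchedFilter_quantize Z β).aemeasurable

lemma charFun_oneBitFilterLaw {m n : ℕ} (Z : Matrix (Fin m) (Fin n) ℂ) (β t : ℂ) :
    charFun (oneBitFilterLaw Z β) t = ∏ q : Fin m × Fin n,
      ∫ w, Complex.exp ((inner ℝ (oneBit (β * Z q.1 q.2 + w)) (filterWeight Z t q) : ℝ)
        * Complex.I) ∂complexGaussian :=
  charFun_matchedFilter Z (f := fun q w => oneBit (β * Z q.1 q.2 + w))
    (fun _ => measurable_oneBit_add _) t

lemma raoCDF_eq {m n : ℕ} {Z : Matrix (Fin m) (Fin n) ℂ}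
    (hZ : ∑ q : Fin m × Fin n, ‖Z q.1 q.2‖ ^ 2 = (m * n : ℕ)) (hN : 0 < m * n) (β : ℂ) (x : ℝ) :
    raoCDF Z β x = (oneBitFilterLaw Z β).real {v : ℂ | ‖v‖ ^ 2 ≤ x} := by
  rw [oneBitFilterLaw, map_measureReal_apply (measurable_matchedFilter_quantize Z β)
    (measurableSet_le (by fun_prop) (by fun_prop))]
  simp only [raoCDF, raoStatistic_eq _ hZ hN]
  rfl

/-- The Gaussian target factors over the same weights, because their squared norms sum to ‖t‖² and
their inner products with the signal sum to √N⟨β, t⟩. All factors lie in the unit disc, so the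
entrywise errors add up. -/
lemma norm_charFun_oneBitFilterLaw_sub_le {m n : ℕ} {Z : Matrix (Fin m) (Fin n) ℂ}
    (hZ : ∑ q : Fin m × Fin n, ‖Z q.1 q.2‖ ^ 2 = (m * n : ℕ)) (hN : 0 < m * n) (β t : ℂ)
    {ε : ℝ} (h : ∀ q : Fin m × Fin n,
      ‖∫ w, Complex.exp ((inner ℝ (oneBit (β * Z q.1 q.2 + w)) (filterWeight Z t q) : ℝ)
          * Complex.I) ∂complexGaussian
        - Complex.exp ((signGain * inner ℝ (β * Z q.1 q.2) (filterWeight Z t q) : ℝ) * Complex.I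
          - (‖filterWeight Z t q‖ ^ 2 / 2 : ℝ))‖
        ≤ ε * (‖filterWeight Z t q‖ ^ 2 + ‖β * Z q.1 q.2‖ ^ 2)) :
    ‖charFun (oneBitFilterLaw Z β) t - charFun (complexGaussian.map
      (· + (signGain * Real.sqrt (m * n : ℕ) : ℝ) * β)) t‖
      ≤ ε * (‖t‖ ^ 2 + (m * n : ℕ) * ‖β‖ ^ 2) := by
  have hlim : charFun (complexGaussian.map (· + (signGain * Real.sqrt (m * n : ℕ) : ℝ) * β)) t
      = ∏ q : Fin m × Fin n, Complex.exp ((signGain * inner ℝ (β * Z q.1 q.2) (filterWeight Z t q)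
          : ℝ) * Complex.I - (‖filterWeight Z t q‖ ^ 2 / 2 : ℝ)) := by
    rw [charFun_complexGaussian_map_add, ← Complex.exp_sum, Finset.sum_sub_distrib,
      ← Finset.sum_mul, ← Complex.ofReal_sum, ← Complex.ofReal_sum, ← Finset.mul_sum,
      ← Finset.sum_div, sum_inner_filterWeight hZ hN, sum_norm_filterWeight_sq hZ hN]
    congr 4
    simp only [inner_eq_re_mul_add_im_mul, Complex.re_ofReal_mul, Complex.im_ofReal_mul]
    ring
  have hsum : ∑ q : Fin m × Fin n, ‖β * Z q.1 q.2‖ ^ 2 = (m * n : ℕ) * ‖β‖ ^ 2 := by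
    simp only [norm_mul, mul_pow]
    rw [← Finset.mul_sum, hZ, mul_comm]
  rw [hlim, charFun_oneBitFilterLaw]
  refine (norm_prod_sub_prod_le _ (fun q _ => norm_integral_exp_inner_le _ _) fun q _ => ?_).trans
    ((Finset.sum_le_sum fun q _ => h q).trans_eq ?_)
  · rw [Complex.norm_exp, Real.exp_le_one_iff]
    simp only [Complex.sub_re, Complex.re_ofReal_mul, Complex.I_re, mul_zero, Complex.ofReal_re]
    linarith [sq_nonneg ‖filterWeight Z t q‖]
  · rw [← Finset.mul_sum, Finset.sum_add_distrib, sum_norm_filterWeight_sq hZ hN, hsum]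

lemma tendsto_natCast_mul_atTop {m : ℕ} (hm : 0 < m) :
    Tendsto (fun n : ℕ => ((m * n : ℕ) : ℝ)) atTop atTop :=
  tendsto_natCast_atTop_atTop.comp (tendsto_id.const_mul_atTop' hm)

/-- Asymptotic law of Rao's statistic from one-bit data. -/
theorem asympEq_raoCDF {m : ℕ} (hm : 0 < m) {Z : (n : ℕ) → Matrix (Fin m) (Fin n) ℂ}
    (hZ : ∀ n, ∑ q : Fin m × Fin n, ‖Z n q.1 q.2‖ ^ 2 = (m * n : ℕ))
    {K : ℝ} (hK : ∀ n i j, ‖Z n i j‖ ≤ K) {β : ℕ → ℂ} {C : ℝ}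
    (hβ : ∀ᶠ n : ℕ in atTop, ((m * n : ℕ) : ℝ) * ‖β n‖ ^ 2 ≤ C) :
    AsympEq (fun n => raoCDF (Z n) (β n))
      (fun n x => (noncentralChiSq 2 (2 * ((m * n : ℕ) : ℝ) / Real.pi * ‖β n‖ ^ 2)).real
        (Set.Iic x)) := by
  let μ : ℕ → ℂ := fun n => (signGain * Real.sqrt (m * n : ℕ) : ℝ) * β n
  have hμsq : ∀ n, ‖μ n‖ ^ 2 = 2 * ((m * n : ℕ) : ℝ) / Real.pi * ‖β n‖ ^ 2 := fun n => by
    simp only [μ]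
    rw [norm_mul, mul_pow, Complex.norm_real, Real.norm_eq_abs, sq_abs, mul_pow, signGain_sq,
      Real.sq_sqrt (Nat.cast_nonneg _)]
    ring
  have hNtop := tendsto_natCast_mul_atTop hm
  have hμ : ∀ᶠ n in atTop, ‖μ n‖ ≤ Real.sqrt (2 / Real.pi * C) := by
    filter_upwards [hβ] with n hn
    refine Real.le_sqrt_of_sq_le ?_
    rw [hμsq]
    calc 2 * ((m * n : ℕ) : ℝ) / Real.pi * ‖β n‖ ^ 2
        = 2 / Real.pi * (((m * n : ℕ) : ℝ) * ‖β n‖ ^ 2) := by ring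
      _ ≤ _ := by gcongr
  -- Bounded entries make no entry dominate: the squared weights are at most K²‖t‖²/N and the
  -- squared means at most K²C/N, uniformly below δ².
  have hsmall : ∀ {D δ : ℝ}, 0 < δ → ∀ᶠ n : ℕ in atTop, K ^ 2 * D ≤ δ ^ 2 * ((m * n : ℕ) : ℝ) := by
    intro D δ hδ
    filter_upwards [hNtop.eventually_ge_atTop (K ^ 2 * D / δ ^ 2)] with n hn
    rwa [div_le_iff₀' (by positivity)] at hn
  have hchar : ∀ t : ℂ, Tendsto (fun n => charFun (oneBitFilterLaw (Z n) (β n)) t -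
      charFun (complexGaussian.map (· + μ n)) t) atTop (𝓝 0) := by
    intro t
    rw [Metric.tendsto_nhds]
    intro ε hε
    have hB : 0 < ‖t‖ ^ 2 + |C| + 1 := by positivity
    obtain ⟨δ, hδ, h⟩ := exists_norm_integral_exp_inner_oneBit_sub_le
      (show 0 < ε / (‖t‖ ^ 2 + |C| + 1) by positivity)
    filter_upwards [hβ, hsmall (D := ‖t‖ ^ 2) hδ, hsmall (D := C) hδ,
      hNtop.eventually_gt_atTop 0] with n hn h1 h2 hNpos
    have hN : 0 < m * n := by exact_mod_cast hNpos
    have hbound := norm_charFun_oneBitFilterLaw_sub_le (hZ n) hN (β n) t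
      (ε := ε / (‖t‖ ^ 2 + |C| + 1)) fun q => by
        refine h _ _ (abs_le_of_sq_le_sq ?_ hδ.le |> fun h => (le_abs_self _).trans h)
          (abs_le_of_sq_le_sq ?_ hδ.le |> fun h => (le_abs_self _).trans h)
        · rw [norm_mul, mul_pow]
          refine le_of_mul_le_mul_right ?_ hNpos
          calc ‖β n‖ ^ 2 * ‖Z n q.1 q.2‖ ^ 2 * ((m * n : ℕ) : ℝ)
              = ‖Z n q.1 q.2‖ ^ 2 * (((m * n : ℕ) : ℝ) * ‖β n‖ ^ 2) := by ring
            _ ≤ K ^ 2 * C := by gcongr; exact hK n q.1 q.2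
            _ ≤ _ := h2
        · rw [norm_filterWeight_sq, inv_mul_le_iff₀ hNpos]
          calc ‖Z n q.1 q.2‖ ^ 2 * ‖t‖ ^ 2 ≤ K ^ 2 * ‖t‖ ^ 2 := by gcongr; exact hK n q.1 q.2
            _ ≤ _ := by linarith
    rw [dist_zero_right]
    calc _ ≤ ε / (‖t‖ ^ 2 + |C| + 1) * (‖t‖ ^ 2 + (m * n : ℕ) * ‖β n‖ ^ 2) := hbound
      _ < ε / (‖t‖ ^ 2 + |C| + 1) * (‖t‖ ^ 2 + |C| + 1) := by
          refine mul_lt_mul_of_pos_left ?_ (by positivity)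
          linarith [le_abs_self C]
      _ = ε := by field_simp
  refine (asympEq_of_charFun_sub_tendsto_zero
    (ν := fun n => ⟨oneBitFilterLaw (Z n) (β n), inferInstance⟩) hμ hchar).congr ?_ ?_
  · filter_upwards [hNtop.eventually_gt_atTop 0] with n hNpos
    funext x
    exact (raoCDF_eq (hZ n) (by exact_mod_cast hNpos) (β n) x).symm
  · exact .of_forall fun n => funext fun x => (noncentralChiSq_two_real_Iic (hμsq n) x).symm

/-! ### Closed form and quadratic approximation of the likelihood ratio. -/

/-- Maximum over `v > 0` of `(π v)⁻ᴺ exp (-A / v)`, attained at `v = A / N`. -/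
noncomputable def peakLikelihood (N : ℕ) (A : ℝ) : ℝ :=
  1 / (Real.pi * (A / N)) ^ N * Real.exp (-N)

lemma likelihood_le_peak {N : ℕ} (hN : 0 < N) {A v : ℝ} (hA : 0 < A) (hv : 0 < v) :
    1 / (Real.pi * v) ^ N * Real.exp (-A / v) ≤ peakLikelihood N A := by
  have hN' : (0 : ℝ) < N := by exact_mod_cast hN
  -- In this variable the claim is the N-th power of u exp(-u) ≤ exp(-1).
  set u : ℝ := A / N / v with hu
  have hu0 : 0 < u := by positivity
  have h1 : u * Real.exp (-u) ≤ Real.exp (-1) := by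
    have h := Real.add_one_le_exp (u - 1)
    rw [sub_add_cancel] at h
    calc u * Real.exp (-u) ≤ Real.exp (u - 1) * Real.exp (-u) := by gcongr
      _ = Real.exp (-1) := by rw [← Real.exp_add]; congr 1; ring
  have h2 : (u * Real.exp (-u)) ^ N ≤ Real.exp (-1) ^ N := by gcongr
  rw [mul_pow, ← Real.exp_nat_mul, ← Real.exp_nat_mul] at h2
  have h3 : (N : ℝ) * -u = -A / v := by rw [hu]; field_simp
  rw [h3, mul_neg_one] at h2
  have h4 : Real.pi * (A / N) = Real.pi * v * u := by rw [hu]; field_simp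
  rw [peakLikelihood, h4, mul_pow (Real.pi * v) u, one_div_mul_eq_div, one_div_mul_eq_div,
    div_le_div_iff₀ (by positivity) (by positivity)]
  calc _ = (Real.pi * v) ^ N * (u ^ N * Real.exp (-A / v)) := by ring
    _ ≤ (Real.pi * v) ^ N * Real.exp (-N) := by gcongr
    _ = _ := by ring

lemma likelihood_at_peak {N : ℕ} (hN : 0 < N) {A : ℝ} (hA : 0 < A) :
    1 / (Real.pi * (A / N)) ^ N * Real.exp (-A / (A / N)) = peakLikelihood N A := by
  have hN' : (0 : ℝ) < N := by exact_mod_cast hN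
  rw [peakLikelihood]
  congr 2
  field_simp

lemma peakLikelihood_div {N : ℕ} (hN : 0 < N) {A B : ℝ} (hA : 0 < A) (hB : 0 < B) :
    peakLikelihood N A / peakLikelihood N B = (B / A) ^ N := by
  have hN' : (0 : ℝ) < N := by exact_mod_cast hN
  rw [peakLikelihood, peakLikelihood, mul_div_mul_right _ _ (Real.exp_pos _).ne',
    one_div, one_div, inv_div_inv, ← div_pow]
  congr 1
  field_simp

section Glrt

variable {m n : ℕ} {Z X : Matrix (Fin m) (Fin n) ℂ}

/-- Total energy of a data matrix. -/
noncomputable def energy (X : Matrix (Fin m) (Fin n) ℂ) : ℝ := ∑ q : Fin m × Fin n, ‖X q.1 q.2‖ ^ 2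

lemma sum_inner_eq_matchedFilter (hN : 0 < m * n) (b : ℂ) :
    ∑ q : Fin m × Fin n, inner ℝ (b * Z q.1 q.2) (X q.1 q.2)
      = inner ℝ ((Real.sqrt (m * n : ℕ) : ℝ) * b) (matchedFilter Z X) := by
  have hN' : (0 : ℝ) < ((m * n : ℕ) : ℝ) := by exact_mod_cast hN
  rw [matchedFilter, inner_sum]
  refine Finset.sum_congr rfl fun q _ => ?_
  have h2 : Real.sqrt ((m * n : ℕ) : ℝ) ≠ 0 := by positivity
  generalize Real.sqrt ((m * n : ℕ) : ℝ) = s at *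
  simp only [inner_eq_re_mul_add_im_mul, Complex.smul_re, Complex.smul_im,
    smul_eq_mul, Complex.mul_re, Complex.mul_im, Complex.star_def, Complex.conj_re,
    Complex.conj_im, Complex.ofReal_re, Complex.ofReal_im]
  field_simp
  ring

/-- Completing the square: the least-squares reflectivity is V/√N, and fitting it removes energy
‖V‖². -/
lemma energy_sub_smul (hZ : ∑ q : Fin m × Fin n, ‖Z q.1 q.2‖ ^ 2 = (m * n : ℕ)) (hN : 0 < m * n)
    (b : ℂ) : ∑ i, ∑ j, ‖X i j - b * Z i j‖ ^ 2 = energy X - ‖matchedFilter Z X‖ ^ 2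
      + ‖matchedFilter Z X - (Real.sqrt (m * n : ℕ) : ℝ) * b‖ ^ 2 := by
  have hb : ‖((Real.sqrt (m * n : ℕ) : ℝ) : ℂ) * b‖ ^ 2 = ‖b‖ ^ 2 * (m * n : ℕ) := by
    rw [norm_mul, mul_pow, Complex.norm_real, Real.norm_eq_abs, sq_abs,
      Real.sq_sqrt (Nat.cast_nonneg _), mul_comm]
  rw [norm_sub_sq_real, real_inner_comm, hb, ← sum_inner_eq_matchedFilter hN,
    ← Fintype.sum_prod_type (f := fun q : Fin m × Fin n => ‖X q.1 q.2 - b * Z q.1 q.2‖ ^ 2), ← hZ,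
    energy, Finset.mul_sum, Finset.mul_sum]
  have : ∀ q : Fin m × Fin n, ‖X q.1 q.2 - b * Z q.1 q.2‖ ^ 2 = ‖X q.1 q.2‖ ^ 2
      - 2 * inner ℝ (b * Z q.1 q.2) (X q.1 q.2) + ‖b‖ ^ 2 * ‖Z q.1 q.2‖ ^ 2 := fun q => by
    rw [norm_sub_sq_real, real_inner_comm, norm_mul, mul_pow]
  simp only [this, Finset.sum_add_distrib, Finset.sum_sub_distrib]
  ring

/-- Strictness of `hX` keeps the residual energy positive; with zero residual the likelihood would
blow up as v → 0 and the supremum would not be a maximum. -/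
lemma glrtStatistic_eq (hZ : ∑ q : Fin m × Fin n, ‖Z q.1 q.2‖ ^ 2 = (m * n : ℕ)) (hN : 0 < m * n)
    (hX : ‖matchedFilter Z X‖ ^ 2 < energy X) :
    glrtStatistic Z X = ((energy X - ‖matchedFilter Z X‖ ^ 2) / energy X) ^ (m * n) := by
  have hN' : (0 : ℝ) < ((m * n : ℕ) : ℝ) := by exact_mod_cast hN
  set A := energy X with hA_def
  set B := A - ‖matchedFilter Z X‖ ^ 2 with hB_def
  have hB : 0 < B := by linarith
  have hA : 0 < A := by linarith [sq_nonneg ‖matchedFilter Z X‖]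
  have hnum : ⨆ v : Set.Ioi (0 : ℝ), gaussianLikelihood Z X 0 v = peakLikelihood (m * n) A := by
    have heq : ∀ v : ℝ, gaussianLikelihood Z X 0 v
        = 1 / (Real.pi * v) ^ (m * n) * Real.exp (-A / v) := fun v => by
      rw [gaussianLikelihood, hA_def, energy, Fintype.sum_prod_type]
      simp only [zero_mul, sub_zero]
    have hle : ∀ v : Set.Ioi (0 : ℝ), gaussianLikelihood Z X 0 v ≤ peakLikelihood (m * n) A :=
      fun v => (heq v).trans_le (likelihood_le_peak hN hA v.2)
    refine le_antisymm (ciSup_le hle) ?_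
    rw [← likelihood_at_peak hN hA, ← heq]
    exact le_ciSup (f := fun v : Set.Ioi (0 : ℝ) => gaussianLikelihood Z X 0 v)
      ⟨_, Set.forall_mem_range.2 hle⟩ ⟨A / (m * n : ℕ), Set.mem_Ioi.2 (by positivity)⟩
  have hden : ⨆ q : ℂ × Set.Ioi (0 : ℝ), gaussianLikelihood Z X q.1 q.2
      = peakLikelihood (m * n) B := by
    have heq : ∀ (b : ℂ) (v : ℝ), gaussianLikelihood Z X b v = 1 / (Real.pi * v) ^ (m * n) *
        Real.exp (-(B + ‖matchedFilter Z X - (Real.sqrt (m * n : ℕ) : ℝ) * b‖ ^ 2) / v) :=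
      fun b v => by rw [gaussianLikelihood, energy_sub_smul hZ hN]
    have hle : ∀ q : ℂ × Set.Ioi (0 : ℝ),
        gaussianLikelihood Z X q.1 q.2 ≤ peakLikelihood (m * n) B := fun q => by
      have hv : (0 : ℝ) < q.2 := q.2.2
      refine (heq q.1 q.2).trans_le (le_trans ?_ (likelihood_le_peak hN hB hv))
      gcongr
      linarith [sq_nonneg ‖matchedFilter Z X - (Real.sqrt (m * n : ℕ) : ℝ) * q.1‖]
    refine le_antisymm (ciSup_le hle) ?_
    have hs : ((Real.sqrt (m * n : ℕ) : ℝ) : ℂ) ≠ 0 := by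
      rw [Complex.ofReal_ne_zero]; positivity
    have h := heq (matchedFilter Z X / (Real.sqrt (m * n : ℕ) : ℝ)) (B / (m * n : ℕ))
    rw [mul_div_cancel₀ _ hs, sub_self, norm_zero, zero_pow two_ne_zero, add_zero,
      likelihood_at_peak hN hB] at h
    rw [← h]
    exact le_ciSup (f := fun q : ℂ × Set.Ioi (0 : ℝ) => gaussianLikelihood Z X q.1 q.2)
      ⟨_, Set.forall_mem_range.2 hle⟩ (_, ⟨B / (m * n : ℕ), Set.mem_Ioi.2 (by positivity)⟩)
  rw [glrtStatistic, hnum, hden, peakLikelihood_div hN hA hB]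

lemma neg_two_log_glrtStatistic_bounds
    (hZ : ∑ q : Fin m × Fin n, ‖Z q.1 q.2‖ ^ 2 = (m * n : ℕ)) (hN : 0 < m * n)
    (hX : ‖matchedFilter Z X‖ ^ 2 < energy X) :
    ‖matchedFilter Z X‖ ^ 2 * (2 * (m * n : ℕ) / energy X)
        ≤ -2 * Real.log (glrtStatistic Z X) ∧
      -2 * Real.log (glrtStatistic Z X) ≤ ‖matchedFilter Z X‖ ^ 2 *
        (2 * (m * n : ℕ) / (energy X - ‖matchedFilter Z X‖ ^ 2)) := by
  rw [glrtStatistic_eq hZ hN hX, Real.log_pow]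
  have hN' : (0 : ℝ) < ((m * n : ℕ) : ℝ) := by exact_mod_cast hN
  generalize ((m * n : ℕ) : ℝ) = N at *
  have hV := sq_nonneg ‖matchedFilter Z X‖
  generalize ‖matchedFilter Z X‖ ^ 2 = V at *
  generalize energy X = A at *
  have hA : 0 < A := by linarith
  have hB : 0 < A - V := by linarith
  have h1 := Real.log_le_sub_one_of_pos (div_pos hB hA)
  have h2 := Real.log_le_sub_one_of_pos (div_pos hA hB)
  rw [← inv_div, Real.log_inv, inv_div] at h2
  have e1 : (A - V) / A - 1 = -(V / A) := by field_simp; ring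
  have e2 : A / (A - V) - 1 = V / (A - V) := by rw [div_sub_one hB.ne']; congr 1; ring
  rw [e1] at h1
  rw [e2] at h2
  constructor
  · calc V * (2 * N / A) = 2 * N * (V / A) := by ring
      _ ≤ 2 * N * -Real.log ((A - V) / A) := by gcongr; linarith
      _ = _ := by ring
  · calc -2 * (N * Real.log ((A - V) / A)) = 2 * N * -Real.log ((A - V) / A) := by ring
      _ ≤ 2 * N * (V / (A - V)) := by gcongr
      _ = _ := by ring

/-- Here 2N/E ≥ 1 - 2η and 2N/(E - V) ≤ 1/(1 - 3η), where V is the squared filter norm; the latter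
is at most 1 + 6η precisely when η ≤ 1/6 (for positive η). -/
lemma abs_neg_two_log_glrtStatistic_sub_le
    (hZ : ∑ q : Fin m × Fin n, ‖Z q.1 q.2‖ ^ 2 = (m * n : ℕ)) (hN : 0 < m * n)
    {η M : ℝ} (hη : 0 ≤ η) (hη' : η ≤ 1 / 6)
    (hV : ‖matchedFilter Z X‖ ^ 2 ≤ M) (hM : M ≤ 2 * (m * n : ℕ) * η)
    (hE : |energy X - 2 * (m * n : ℕ)| ≤ 2 * (2 * (m * n : ℕ) * η)) :
    |-2 * Real.log (glrtStatistic Z X) - ‖matchedFilter Z X‖ ^ 2| ≤ 6 * η * M := by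
  have hN' : (0 : ℝ) < ((m * n : ℕ) : ℝ) := by exact_mod_cast hN
  obtain ⟨hE1, hE2⟩ := abs_le.1 hE
  have hprod : 2 * ((m * n : ℕ) : ℝ) * η ≤ 2 * ((m * n : ℕ) : ℝ) * (1 / 6) := by gcongr
  obtain ⟨h1, h2⟩ := neg_two_log_glrtStatistic_bounds hZ hN (X := X) (by linarith)
  generalize -2 * Real.log (glrtStatistic Z X) = T at *
  generalize ((m * n : ℕ) : ℝ) = N at *
  have hV0 := sq_nonneg ‖matchedFilter Z X‖
  generalize ‖matchedFilter Z X‖ ^ 2 = V at *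
  generalize energy X = A at *
  have hA : 0 < A := by linarith
  have hB : 0 < A - V := by linarith
  have hlow : 1 - 2 * η ≤ 2 * N / A := by
    rw [le_div_iff₀ hA]
    have : (1 - 2 * η) * A ≤ (1 - 2 * η) * (2 * N + 2 * (2 * N * η)) := by
      refine mul_le_mul_of_nonneg_left ?_ ?_ <;> linarith
    nlinarith [mul_nonneg hN'.le (mul_nonneg hη hη)]
  have hhigh : 2 * N / (A - V) ≤ 1 + 6 * η := by
    rw [div_le_iff₀ hB]
    have : (1 + 6 * η) * (2 * N - 2 * N * η * 3) ≤ (1 + 6 * η) * (A - V) := by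
      refine mul_le_mul_of_nonneg_left ?_ ?_ <;> linarith
    have h3 : 0 ≤ N * η * (1 - 6 * η) :=
      mul_nonneg (mul_nonneg hN'.le hη) (by linarith)
    nlinarith
  have h3 : V * (1 - 2 * η) ≤ V * (2 * N / A) := by gcongr
  have h4 : V * (2 * N / (A - V)) ≤ V * (1 + 6 * η) := by gcongr
  have h5 : η * V ≤ η * M := by gcongr
  have h6 : 0 ≤ η * V := mul_nonneg hη hV0
  rw [abs_le]
  constructor <;> linarith

end Glrt

/-! ### Exact law of the unquantized filter output and concentration of the noise energy. -/

section Noise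

variable {m n : ℕ} {Z : Matrix (Fin m) (Fin n) ℂ}

lemma measurable_matchedFilter_noise (Z : Matrix (Fin m) (Fin n) ℂ) :
    Measurable fun W : Fin m → Fin n → ℂ => matchedFilter Z (Matrix.of W) :=
  measurable_matchedFilter Z (f := fun _ w => w) fun _ => measurable_id

lemma map_matchedFilter_noise (hZ : ∑ q : Fin m × Fin n, ‖Z q.1 q.2‖ ^ 2 = (m * n : ℕ))
    (hN : 0 < m * n) :
    (noiseLaw m n).map (fun W => matchedFilter Z (Matrix.of W)) = complexGaussian := by
  have : IsProbabilityMeasure ((noiseLaw m n).map fun W => matchedFilter Z (Matrix.of W)) :=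
    Measure.isProbabilityMeasure_map (measurable_matchedFilter_noise Z).aemeasurable
  refine Measure.ext_of_charFun (funext fun t => ?_)
  have h := charFun_matchedFilter Z (f := fun _ w => w) (fun _ => measurable_id) t
  refine h.trans ?_
  have h' : ∀ u : ℂ, ∫ w, Complex.exp ((inner ℝ w u : ℝ) * Complex.I) ∂complexGaussian
      = Complex.exp (-(‖u‖ ^ 2 / 2 : ℝ)) := fun u => by
    rw [← charFun_complexGaussian, charFun_apply]
  simp only [h']
  rw [← Complex.exp_sum, charFun_complexGaussian, Finset.sum_neg_distrib, ← Complex.ofReal_sum,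
    ← Finset.sum_div, sum_norm_filterWeight_sq hZ hN]

lemma matchedFilter_received (hZ : ∑ q : Fin m × Fin n, ‖Z q.1 q.2‖ ^ 2 = (m * n : ℕ))
    (hN : 0 < m * n) (β : ℂ) (W : Fin m → Fin n → ℂ) :
    matchedFilter Z (received Z β W)
      = matchedFilter Z (Matrix.of W) + (Real.sqrt (m * n : ℕ) : ℝ) * β := by
  have hN' : (0 : ℝ) < ((m * n : ℕ) : ℝ) := by exact_mod_cast hN
  have h1 : ∀ q : Fin m × Fin n, star (Z q.1 q.2) * received Z β W q.1 q.2
      = star (Z q.1 q.2) * Matrix.of W q.1 q.2 + (‖Z q.1 q.2‖ ^ 2 : ℝ) * β := fun q => by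
    have : ((‖Z q.1 q.2‖ ^ 2 : ℝ) : ℂ) = star (Z q.1 q.2) * Z q.1 q.2 := by
      rw [Complex.star_def, ← Complex.normSq_eq_conj_mul_self, Complex.sq_norm]
    rw [this]
    simp only [received, Matrix.add_apply, Matrix.smul_apply, smul_eq_mul]
    ring
  simp only [matchedFilter, h1, smul_add, Finset.sum_add_distrib]
  congr 1
  rw [← Finset.smul_sum, ← Finset.sum_mul, ← Complex.ofReal_sum, hZ, Complex.real_smul, ← mul_assoc,
    ← Complex.ofReal_mul]
  congr 2
  rw [inv_mul_eq_div, Real.div_sqrt]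

/-- The signal changes the energy only through V(W) and N‖β‖², which is bounded when those are,
hence negligible against 2N. -/
lemma energy_received (hN : 0 < m * n)
    (hZ : ∑ q : Fin m × Fin n, ‖Z q.1 q.2‖ ^ 2 = (m * n : ℕ)) (β : ℂ) (W : Fin m → Fin n → ℂ) :
    energy (received Z β W) = energy (Matrix.of W)
      + 2 * inner ℝ ((Real.sqrt (m * n : ℕ) : ℝ) * β) (matchedFilter Z (Matrix.of W))
      + (m * n : ℕ) * ‖β‖ ^ 2 := by
  rw [← sum_inner_eq_matchedFilter hN, ← hZ, Finset.sum_mul, Finset.mul_sum, energy, energy,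
    ← Finset.sum_add_distrib, ← Finset.sum_add_distrib]
  refine Finset.sum_congr rfl fun q _ => ?_
  simp only [received, Matrix.add_apply, Matrix.smul_apply, smul_eq_mul]
  rw [add_comm, norm_add_sq_real, norm_mul, mul_pow, real_inner_comm]
  ring

lemma integral_sq_gaussianReal : ∫ x, x ^ 2 ∂gaussianReal 0 1 = 1 := by
  have h := variance_id_gaussianReal (μ := 0) (v := 1)
  rw [variance_of_integral_eq_zero aemeasurable_id (by simp)] at h
  simpa using h

lemma integrable_re_pow_complexGaussian (k : ℕ) :
    Integrable (fun w => w.re ^ k) complexGaussian ∧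
      Integrable (fun w => w.im ^ k) complexGaussian := by
  have h : Integrable (fun x : ℝ => x ^ k) (gaussianReal 0 1) := by
    have := (memLp_id_gaussianReal (μ := 0) (v := 1) k)
    exact (this.integrable_norm_pow').mono' (by fun_prop) (by simp)
  have h1 := h.comp_fst (gaussianReal 0 1)
  have h2 := h.comp_snd (gaussianReal 0 1)
  constructor
  · exact (measurePreserving_complexGaussian.integrable_comp_emb
      Complex.measurableEquivRealProd.symm.measurableEmbedding).1 h1
  · exact (measurePreserving_complexGaussian.integrable_comp_emb
      Complex.measurableEquivRealProd.symm.measurableEmbedding).1 h2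

lemma norm_sq_eq_re_sq_add_im_sq (w : ℂ) : ‖w‖ ^ 2 = w.re ^ 2 + w.im ^ 2 := by
  rw [Complex.sq_norm, Complex.normSq_apply]; ring

lemma integral_norm_sq_complexGaussian : ∫ w, ‖w‖ ^ 2 ∂complexGaussian = 2 := by
  have hre : ∫ w, w.re ^ 2 ∂complexGaussian = 1 := by
    have h := integral_complexGaussian_mul (fun x : ℝ => x ^ 2) fun _ => (1 : ℝ)
    rw [integral_sq_gaussianReal] at h
    simpa only [mul_one, integral_const, probReal_univ, one_smul] using h
  have him : ∫ w, w.im ^ 2 ∂complexGaussian = 1 := by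
    have h := integral_complexGaussian_mul (fun _ => (1 : ℝ)) fun x : ℝ => x ^ 2
    rw [integral_sq_gaussianReal] at h
    simpa only [one_mul, mul_one, integral_const, probReal_univ, one_smul] using h
  simp only [norm_sq_eq_re_sq_add_im_sq]
  rw [integral_add (integrable_re_pow_complexGaussian 2).1 (integrable_re_pow_complexGaussian 2).2,
    hre, him]
  norm_num

lemma memLp_norm_sq_complexGaussian : MemLp (fun w : ℂ => ‖w‖ ^ 2) 2 complexGaussian := by
  rw [memLp_two_iff_integrable_sq (by fun_prop)]
  obtain ⟨h1, h2⟩ := integrable_re_pow_complexGaussian 4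
  refine ((h1.add h2).const_mul 2).mono' (by fun_prop) (ae_of_all _ fun w => ?_)
  rw [Real.norm_eq_abs, abs_of_nonneg (by positivity), norm_sq_eq_re_sq_add_im_sq]
  simp only [Pi.add_apply]
  nlinarith [sq_nonneg (w.re ^ 2 - w.im ^ 2)]

/-- Weak law of large numbers for the noise energy. -/
lemma exists_noise_energy_deviation_le :
    ∃ v : ℝ, ∀ (m n : ℕ) (c : ℝ), 0 < c →
      (noiseLaw m n).real {W | c ≤ |energy (Matrix.of W) - 2 * (m * n : ℕ)|}
        ≤ (m * n : ℕ) * v / c ^ 2 := by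
  refine ⟨Var[fun w : ℂ => ‖w‖ ^ 2; complexGaussian], fun m n c hc => ?_⟩
  have hL : ∀ q : Fin m × Fin n,
      MemLp (fun W : Fin m → Fin n → ℂ => ‖W q.1 q.2‖ ^ 2) 2 (noiseLaw m n) := fun q =>
    memLp_norm_sq_complexGaussian.comp_measurePreserving (measurePreserving_noise_entry q)
  have hmeas : Measurable fun w : ℂ => ‖w‖ ^ 2 := by fun_prop
  have hE : ∫ W, energy (Matrix.of W) ∂noiseLaw m n = 2 * (m * n : ℕ) := by
    simp only [energy, Matrix.of_apply]
    rw [integral_finsetSum _ fun q _ => (hL q).integrable one_le_two]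
    have : ∀ q : Fin m × Fin n, ∫ W, ‖W q.1 q.2‖ ^ 2 ∂noiseLaw m n = 2 := fun q =>
      (integral_noise_entry q (f := fun w => ‖w‖ ^ 2) hmeas.aestronglyMeasurable).trans
        integral_norm_sq_complexGaussian
    simp only [this]
    simp [mul_comm]
  have hvar : Var[fun W => energy (Matrix.of W); noiseLaw m n]
      = (m * n : ℕ) * Var[fun w : ℂ => ‖w‖ ^ 2; complexGaussian] := by
    have h := IndepFun.variance_sum (s := Finset.univ)
      (X := fun (q : Fin m × Fin n) (W : Fin m → Fin n → ℂ) => ‖W q.1 q.2‖ ^ 2)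
      (fun q _ => hL q) fun q _ q' _ hq =>
        ((iIndepFun_noise_entry m n).indepFun hq).comp hmeas hmeas
    have hv : ∀ q : Fin m × Fin n, Var[fun W : Fin m → Fin n → ℂ => ‖W q.1 q.2‖ ^ 2; noiseLaw m n]
        = Var[fun w : ℂ => ‖w‖ ^ 2; complexGaussian] := fun q => by
      rw [← (measurePreserving_noise_entry q).map_eq, variance_map (by fun_prop)
        (measurePreserving_noise_entry q).measurable.aemeasurable]
      rfl
    simp only [hv, Finset.sum_const, Finset.card_univ, Fintype.card_prod, Fintype.card_fin,
      nsmul_eq_mul] at h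
    rw [← h]
    congr 1
    ext W
    simp [energy]
  have hLE : MemLp (fun W : Fin m → Fin n → ℂ => energy (Matrix.of W)) 2 (noiseLaw m n) :=
    memLp_finsetSum _ fun q _ => hL q
  have h := meas_ge_le_variance_div_sq hLE hc
  rw [hE, hvar] at h
  exact ENNReal.toReal_le_of_le_ofReal
    (div_nonneg (mul_nonneg (Nat.cast_nonneg _) (variance_nonneg _ _)) (sq_nonneg c)) h

lemma matchedFilter_received_cdf (hZ : ∑ q : Fin m × Fin n, ‖Z q.1 q.2‖ ^ 2 = (m * n : ℕ))
    (hN : 0 < m * n) (β : ℂ) (x : ℝ) :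
    (noiseLaw m n).real {W | ‖matchedFilter Z (received Z β W)‖ ^ 2 ≤ x}
      = shiftedNormSqCDF ((Real.sqrt (m * n : ℕ) : ℝ) * β) x := by
  rw [shiftedNormSqCDF, ← map_matchedFilter_noise hZ hN, map_measureReal_apply
    (measurable_matchedFilter_noise Z) (measurableSet_le (by fun_prop) (by fun_prop))]
  simp only [matchedFilter_received hZ hN]
  rfl

end Noise

/-! ### Asymptotic law of the likelihood ratio statistic. -/

lemma le_add_of_approx {Ω : Type*} [MeasurableSpace Ω] {μ : Measure Ω} [IsFiniteMeasure μ]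
    {T V : Ω → ℝ} {B : Set Ω} {η δ : ℝ} (hB : μ.real B ≤ δ) (h : ∀ ω ∉ B, |T ω - V ω| ≤ η) (x : ℝ) :
    μ.real {ω | T ω ≤ x} ≤ μ.real {ω | V ω ≤ x + η} + δ := by
  have hsub : {ω | T ω ≤ x} ⊆ {ω | V ω ≤ x + η} ∪ B := fun ω (hω : T ω ≤ x) => by
    by_cases hb : ω ∈ B
    · exact Or.inr hb
    · refine Or.inl (show V ω ≤ x + η from ?_)
      linarith [(abs_le.1 (h ω hb)).1]
  exact (measureReal_mono hsub).trans ((measureReal_union_le _ _).trans (by linarith))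

/-- Asymptotic law of the generalized likelihood ratio statistic from unquantized data. -/
theorem asympEq_glrtCDF {m : ℕ} (hm : 0 < m) {Z : (n : ℕ) → Matrix (Fin m) (Fin n) ℂ}
    (hZ : ∀ n, ∑ q : Fin m × Fin n, ‖Z n q.1 q.2‖ ^ 2 = (m * n : ℕ)) {β : ℕ → ℂ} {C : ℝ}
    (hβ : ∀ᶠ n : ℕ in atTop, ((m * n : ℕ) : ℝ) * ‖β n‖ ^ 2 ≤ C) :
    AsympEq (fun n => glrtCDF (Z n) (β n))
      (fun n x => (noncentralChiSq 2 (((m * n : ℕ) : ℝ) * ‖β n‖ ^ 2)).real (Set.Iic x)) := by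
  let c : ℕ → ℂ := fun n => (Real.sqrt (m * n : ℕ) : ℝ) * β n
  have hcsq : ∀ n, ‖c n‖ ^ 2 = ((m * n : ℕ) : ℝ) * ‖β n‖ ^ 2 := fun n => by
    simp only [c]
    rw [norm_mul, mul_pow, Complex.norm_real, Real.norm_eq_abs, sq_abs,
      Real.sq_sqrt (Nat.cast_nonneg _)]
  suffices AsympEq (fun n => glrtCDF (Z n) (β n)) fun n => shiftedNormSqCDF (c n) from
    this.congr (.of_forall fun _ => rfl)
      (.of_forall fun n => funext fun x => (noncentralChiSq_two_real_Iic (hcsq n) x).symm)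
  refine asympEq_of_shift (fun n x h => shiftedNormSqCDF_add_le (c n) x) fun η hη δ hδ => ?_
  have hNtop := tendsto_natCast_mul_atTop hm
  obtain ⟨v, hv⟩ := exists_noise_energy_deviation_le
  obtain ⟨x₀, hx₀, hx₀nn⟩ := (((tendsto_shiftedNormSqCDF_atTop 0).eventually_const_le
    (show 1 - δ / 2 < 1 by linarith)).and (eventually_ge_atTop 0)).exists
  set R : ℝ := Real.sqrt x₀ with hR
  set D : ℝ := Real.sqrt C with hD
  have hR0 : 0 ≤ R := Real.sqrt_nonneg _
  have hD0 : 0 ≤ D := Real.sqrt_nonneg _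
  set M : ℝ := (R + D) ^ 2 with hM
  have hM0 : 0 ≤ M := sq_nonneg _
  -- Relative tolerance for the energy: 1/6 is the range of the quadratic approximation, and the
  -- other bound makes its error 6rM at most η.
  set r : ℝ := min (1 / 6) (η / (6 * (M + 1))) with hr
  have hr0 : 0 < r := by rw [hr]; positivity
  have hrM : 6 * r * M ≤ η := by
    have h1 : r ≤ η / (6 * (M + 1)) := min_le_right _ _
    rw [le_div_iff₀ (by positivity)] at h1
    linarith
  -- The three thresholds on N ensure M ≤ 2Nr, a signal contribution 2DR + D² ≤ 2Nr to the energy,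
  -- and a Chebyshev bound v/(4Nr²) ≤ δ/2.
  filter_upwards [hβ, hNtop.eventually_gt_atTop 0, hNtop.eventually_ge_atTop (M / (2 * r)),
    hNtop.eventually_ge_atTop ((2 * D * R + D ^ 2) / (2 * r)),
    hNtop.eventually_ge_atTop (v / (2 * r ^ 2 * δ))] with n hn hNpos hN1 hN2 hN3
  have hN : 0 < m * n := by exact_mod_cast hNpos
  rw [div_le_iff₀ (by positivity)] at hN1 hN2 hN3
  have hcD : ‖c n‖ ≤ D := Real.le_sqrt_of_sq_le ((hcsq n).trans_le hn)
  let B : Set (Fin m → Fin n → ℂ) :=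
    {W | ¬ ‖matchedFilter (Z n) (Matrix.of W)‖ ^ 2 ≤ x₀} ∪
      {W | 2 * (m * n : ℕ) * r ≤ |energy (Matrix.of W) - 2 * (m * n : ℕ)|}
  have hB : (noiseLaw m n).real B ≤ δ := by
    have h1 : (noiseLaw m n).real {W | ¬ ‖matchedFilter (Z n) (Matrix.of W)‖ ^ 2 ≤ x₀} ≤ δ / 2 := by
      have hms : MeasurableSet {W | ‖matchedFilter (Z n) (Matrix.of W)‖ ^ 2 ≤ x₀} :=
        measurableSet_le ((measurable_matchedFilter_noise (Z n)).norm.pow_const 2) measurable_const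
      have h2 := probReal_compl_eq_one_sub (μ := noiseLaw m n) hms
      have h3 : (noiseLaw m n).real {W | ‖matchedFilter (Z n) (Matrix.of W)‖ ^ 2 ≤ x₀}
          = shiftedNormSqCDF 0 x₀ := by
        have := matchedFilter_received_cdf (hZ n) hN 0 x₀
        simpa [received] using this
      rw [h3] at h2
      refine (le_of_eq h2).trans ?_
      linarith
    have h2 : (noiseLaw m n).real
        {W | 2 * (m * n : ℕ) * r ≤ |energy (Matrix.of W) - 2 * (m * n : ℕ)|} ≤ δ / 2 := by
      refine (hv m n _ (by positivity)).trans ?_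
      rw [div_le_iff₀ (by positivity)]
      calc ((m * n : ℕ) : ℝ) * v ≤ (m * n : ℕ) * ((m * n : ℕ) * (2 * r ^ 2 * δ)) := by gcongr
        _ = _ := by ring
    exact (measureReal_union_le _ _).trans (by linarith)
  have happrox : ∀ W ∉ B, |-2 * Real.log (glrtStatistic (Z n) (received (Z n) (β n) W))
      - ‖matchedFilter (Z n) (received (Z n) (β n) W)‖ ^ 2| ≤ η := by
    intro W hW
    simp only [B, Set.mem_union, not_or] at hW
    have hW1 : ‖matchedFilter (Z n) (Matrix.of W)‖ ^ 2 ≤ x₀ := not_not.1 hW.1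
    have hW2 : |energy (Matrix.of W) - 2 * (m * n : ℕ)| < 2 * (m * n : ℕ) * r := not_le.1 hW.2
    have hVR : ‖matchedFilter (Z n) (Matrix.of W)‖ ≤ R := Real.le_sqrt_of_sq_le hW1
    have hV : ‖matchedFilter (Z n) (received (Z n) (β n) W)‖ ^ 2 ≤ M := by
      rw [matchedFilter_received (hZ n) hN, hM]
      gcongr
      exact (norm_add_le _ _).trans (add_le_add hVR hcD)
    refine (abs_neg_two_log_glrtStatistic_sub_le (hZ n) hN hr0.le (min_le_left _ _) hV
      (by linarith) ?_).trans hrM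
    have hin : |inner ℝ (c n) (matchedFilter (Z n) (Matrix.of W))| ≤ D * R :=
      (abs_real_inner_le_norm _ _).trans (by gcongr)
    have hcn : ((m * n : ℕ) : ℝ) * ‖β n‖ ^ 2 ≤ D ^ 2 := by
      rw [← hcsq]; gcongr
    have hcn0 : 0 ≤ ((m * n : ℕ) : ℝ) * ‖β n‖ ^ 2 := by positivity
    rw [energy_received hN (hZ n)]
    obtain ⟨h1, h2⟩ := abs_le.1 hin
    obtain ⟨h3, h4⟩ := abs_lt.1 hW2
    simp only [c] at h1 h2
    rw [abs_le]
    constructor <;> linarith [mul_nonneg hD0 hR0, sq_nonneg D]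
  intro x
  rw [← matchedFilter_received_cdf (hZ n) hN, ← matchedFilter_received_cdf (hZ n) hN, glrtCDF]
  refine ⟨le_add_of_approx hB happrox x, ?_⟩
  have := le_add_of_approx (T := fun W => ‖matchedFilter (Z n) (received (Z n) (β n) W)‖ ^ 2)
    hB (fun W hW => (abs_sub_comm _ _).trans_le (happrox W hW)) (x - η)
  rwa [sub_add_cancel] at this

/-! ### Hypotheses in usable form, the decibel value and the conclusion. -/

lemma sum_norm_sq_eq_of_trace {m n : ℕ} {Z : Matrix (Fin m) (Fin n) ℂ} {N : ℕ}
    (h : (Z * Zᴴ).trace = (N : ℂ)) : ∑ q : Fin m × Fin n, ‖Z q.1 q.2‖ ^ 2 = N := by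
  rw [Fintype.sum_prod_type]
  have : ((∑ i, ∑ j, ‖Z i j‖ ^ 2 : ℝ) : ℂ) = (N : ℂ) := by
    rw [← h]
    simp only [Matrix.trace, Matrix.diag, Matrix.mul_apply, Matrix.conjTranspose_apply]
    push_cast
    simp only [Complex.star_def, Complex.mul_conj']
  exact_mod_cast this

lemma eventually_mul_norm_sq_le {m : ℕ} {β : ℕ → ℂ}
    (hβ : β =O[atTop] fun n : ℕ => ((m * n : ℕ) : ℝ) ^ (-(1 / 2) : ℝ)) :
    ∃ C, ∀ᶠ n : ℕ in atTop, ((m * n : ℕ) : ℝ) * ‖β n‖ ^ 2 ≤ C := by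
  obtain ⟨c, hc⟩ := hβ.bound
  refine ⟨c ^ 2, hc.mono fun n hn => ?_⟩
  have hN : (0 : ℝ) ≤ ((m * n : ℕ) : ℝ) := Nat.cast_nonneg _
  generalize ((m * n : ℕ) : ℝ) = N at *
  rw [Real.norm_of_nonneg (Real.rpow_nonneg hN _)] at hn
  rcases hN.eq_or_lt with rfl | hN
  · simpa using sq_nonneg c
  · have h2 : (N ^ (-(1 / 2) : ℝ)) ^ 2 = N⁻¹ := by
      rw [← Real.rpow_natCast, ← Real.rpow_mul hN.le, ← Real.rpow_neg_one]
      norm_num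
    calc N * ‖β n‖ ^ 2 ≤ N * (c * N ^ (-(1 / 2) : ℝ)) ^ 2 := by gcongr
      _ = c ^ 2 := by rw [mul_pow, h2]; field_simp

/-- Taking 200th powers reduces this to the integer-exponent comparisons 10³⁹ < 1.57²⁰⁰ and 1.575²⁰⁰
< 10⁴¹. -/
lemma abs_ten_logb_half_pi_sub_two_lt : |10 * Real.logb 10 (Real.pi / 2) - 2| < 1 / 20 := by
  have h1 : (39 / 200 : ℝ) < Real.logb 10 (Real.pi / 2) := by
    rw [Real.lt_logb_iff_rpow_lt (by norm_num) (by positivity)]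
    have h : (10 : ℝ) ^ (39 / 200 : ℝ) < 3.14 / 2 := by
      refine lt_of_pow_lt_pow_left₀ 200 (by norm_num) ?_
      rw [← Real.rpow_natCast, ← Real.rpow_mul (by norm_num)]
      norm_num
    linarith [Real.pi_gt_d2]
  have h2 : Real.logb 10 (Real.pi / 2) < (41 / 200 : ℝ) := by
    rw [Real.logb_lt_iff_lt_rpow (by norm_num) (by positivity)]
    have h : (3.15 / 2 : ℝ) < (10 : ℝ) ^ (41 / 200 : ℝ) := by
      refine lt_of_pow_lt_pow_left₀ 200 (by positivity) ?_
      rw [← Real.rpow_natCast ((10 : ℝ) ^ (41 / 200 : ℝ)), ← Real.rpow_mul (by norm_num)]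
      norm_num
    linarith [Real.pi_lt_d2]
  rw [abs_lt]
  constructor <;> linarith

end OneBitRadar

theorem theorem4 (m p : ℕ) (hm : 0 < m) (aR : Fin m → ℂ) (aT : Fin p → ℂ)
    (S : (n : ℕ) → Matrix (Fin p) (Fin n) ℂ)
    (hpower : ∀ n, (target aR aT (S n) * (target aR aT (S n))ᴴ).trace = ((m * n : ℕ) : ℂ))
    (hbdd : ∃ K : ℝ, ∀ n i j, ‖target aR aT (S n) i j‖ ≤ K)
    (β : ℕ → ℂ) (hβ : β =O[atTop] fun n : ℕ => ((m * n : ℕ) : ℝ) ^ (-(1 / 2) : ℝ)) :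
    AsympEq (fun n => raoCDF (target aR aT (S n)) (β n))
        (fun n x => (noncentralChiSq 2 (2 * ((m * n : ℕ) : ℝ) / Real.pi * ‖β n‖ ^ 2)).real
          (Set.Iic x)) ∧
      AsympEq (fun n => glrtCDF (target aR aT (S n)) (β n))
        (fun n x => (noncentralChiSq 2 (((m * n : ℕ) : ℝ) * ‖β n‖ ^ 2)).real (Set.Iic x)) ∧
      (∀ n, 0 < n → β n ≠ 0 →
        (((m * n : ℕ) : ℝ) * ‖β n‖ ^ 2) / (2 * ((m * n : ℕ) : ℝ) / Real.pi * ‖β n‖ ^ 2)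
          = Real.pi / 2) ∧
      AsympEq (fun n => raoCDF (target aR aT (S n)) ((Real.sqrt (Real.pi / 2) : ℂ) * β n))
        (fun n => glrtCDF (target aR aT (S n)) (β n)) ∧
      |10 * Real.logb 10 (Real.pi / 2) - 2| < 1 / 20 := by
  obtain ⟨K, hK⟩ := hbdd
  obtain ⟨C, hC⟩ := eventually_mul_norm_sq_le hβ
  have hZ := fun n => sum_norm_sq_eq_of_trace (hpower n)
  have hglrt := asympEq_glrtCDF hm hZ hC
  refine ⟨asympEq_raoCDF hm hZ hK hC, hglrt, fun n hn hβn => ?_, ?_,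
    abs_ten_logb_half_pi_sub_two_lt⟩
  · have h1 : ((m * n : ℕ) : ℝ) ≠ 0 := by exact_mod_cast (Nat.mul_pos hm hn).ne'
    have h2 : ‖β n‖ ≠ 0 := norm_ne_zero_iff.2 hβn
    have h3 := Real.pi_ne_zero
    field_simp
  · have hnorm : ∀ n, ‖(Real.sqrt (Real.pi / 2) : ℂ) * β n‖ ^ 2 = Real.pi / 2 * ‖β n‖ ^ 2 :=
      fun n => by
        rw [norm_mul, mul_pow, Complex.norm_real, Real.norm_eq_abs, sq_abs,
          Real.sq_sqrt (by positivity)]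
    -- Amplifying β by √(π/2) makes the one-bit noncentrality equal to N‖β‖², so both statistics
    -- share the same approximating law.
    have hrao := asympEq_raoCDF hm hZ hK (β := fun n => (Real.sqrt (Real.pi / 2) : ℂ) * β n)
      (C := Real.pi / 2 * C) (hC.mono fun n hn => by
        rw [hnorm, mul_left_comm]; gcongr)
    refine (hrao.congr (.of_forall fun _ => rfl) (.of_forall fun n => ?_)).trans hglrt.symm
    funext x
    have : 2 * ((m * n : ℕ) : ℝ) / Real.pi * (Real.pi / 2 * ‖β n‖ ^ 2)
        = ((m * n : ℕ) : ℝ) * ‖β n‖ ^ 2 := by field_simp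
    rw [hnorm, this]
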